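/- Let $\{\eta_{i,j} : j\in\{i+1,i+2\},\ i\ge 0\}$ be i.i.d. strictly positive random variables with continuous (atomless) distribution and $\mathbb{E}\log^+\eta_{i,j}<\infty$ (so $\mathbb{E}\log\eta_{i,j}\in[-\infty,\infty)$), let $n_0>0$, and let $\mathcal I_0$ be a (possibly random) variable with values in a bounded subset of $(0,\infty)$. Put $$A_i=\begin{bmatrix}0&1\\ \eta_{i-2,i}&\eta_{i-1,i}\end{bmatrix},\qquad B_i=\begin{bmatrix}0&1&\delta\\ \eta_{i-2,i}^2&\eta_{i-1,i}^2&n_0\\ 0&0&1\end{bmatrix}\qquad(i\ge 2),$$ where $\delta$ is either $n_0$ or $0$. Let $\mathcal I_1=\eta_{0,1}\mathcal I_0$ and $\mathcal I_n=\eta_{n-1,n}\mathcal I_{n-1}+\eta_{n-2,n}\mathcal I_{n-2}$ for $n\ge2$ (the information signal, so that $(\mathcal I_{n-1},\mathcal I_n)^T=A_n\cdots A_2(\mathcal I_0,\mathcal I_1)^T$), let $\mathcal N_n^2$ be the second coordinate of $B_n\cdots B_2\,(0,0,1)^T$ (the noise power), and let $\gamma_n=\mathcal I_n^2/\mathcal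 N_n^2$ and $c_n=\log(1+\gamma_n)$ be the signal-to-noise ratio and the end-to-end capacity of the cooperative amplify-and-forward relay network. Let $\lambda=\lim_{n\to\infty}\frac1n\mathbb{E}\log\|A_n\cdots A_2\|\in[-\infty,\infty)$ be the upper Lyapunov exponent of the random matrix product. Then, if $\lambda>-\infty$, $$c_n=\Theta_{\mathbb P}\bigl(\exp(n\min\{0,2\lambda\})\bigr),$$ that is, there are deterministic $h(n), h'(n)\ge0$, both $o(n)$, with $\mathbb P[c_n\le e^{n\min\{0,2\lambda\}}e^{h(n)}]\to1$ and $\mathbb P[c_n\ge e^{n\min\{0,2\lambda\}}e^{-h'(n)}]\to1$ as $n\to\infty$. Moreover, in all cases, $\frac1n\log c_n\to\min\{0,2\lambda\}$ in probability (in $[-\infty,\infty)$). If in addition $\mathbb{E}|\log\eta_{i,j}|<\infty$, then $\lambda>-\infty$ and this convergence also holds almost surely. -/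

import Mathlib

open MeasureTheory ProbabilityTheory Filter Topology

namespace AFRelay

noncomputable section

/-- The pairs `(i, j)` such that node `j` listens to node `i`: `j = i + 1` or `j = i + 2`. -/
abbrev Link : Type := {p : ℕ × ℕ // p.2 = p.1 + 1 ∨ p.2 = p.1 + 2}

/-- The ordered product `∏_{i=2}^n M i = M n * M (n-1) * ⋯ * M 2` (empty for `n ≤ 1`). -/
def orderedProd {d : ℕ} (M : ℕ → Matrix (Fin d) (Fin d) ℝ) : ℕ → Matrix (Fin d) (Fin d) ℝ
  | 0 => 1
  | 1 => 1
  | n + 2 => M (n + 2) * orderedProd M (n + 1)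

/-- The transfer matrix of the information symbol at node `i` (used for `2 ≤ i` only). -/
def infoMatrix (η : ℕ → ℕ → ℝ) (i : ℕ) : Matrix (Fin 2) (Fin 2) ℝ :=
  !![0, 1; η (i - 2) i, η (i - 1) i]

/-- The magnitude `I n` of the transmitted information signal at node `n`: the Fibonacci-type
recursion with `I 1 = η 0 1 * I 0`. -/
def signal (η : ℕ → ℕ → ℝ) (I₀ : ℝ) : ℕ → ℝ
  | 0 => I₀
  | 1 => η 0 1 * I₀
  | n + 2 => η (n + 1) (n + 2) * signal η I₀ (n + 1) + η n (n + 2) * signal η I₀ n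

/-- The matrix expression of the recursion. -/
theorem orderedProd_infoMatrix_mulVec (η : ℕ → ℕ → ℝ) (I₀ : ℝ) (n : ℕ) :
    (orderedProd (infoMatrix η) (n + 1)).mulVec ![I₀, η 0 1 * I₀]
      = ![signal η I₀ n, signal η I₀ (n + 1)] := by
  induction n with
  | zero => simp [orderedProd, signal]
  | succ n ih =>
    rw [orderedProd, ← Matrix.mulVec_mulVec, ih]
    ext k
    fin_cases k
    · simp [infoMatrix, Matrix.mulVec, dotProduct, Fin.sum_univ_two]
    · simp [infoMatrix, Matrix.mulVec, dotProduct, Fin.sum_univ_two, signal]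
      ring

/-- The transfer matrix of the noise power at node `i` (used for `2 ≤ i` only), with additive
noise terms `δ` and `n₀` in its first two rows. -/
def noiseMatrix (η : ℕ → ℕ → ℝ) (n₀ δ : ℝ) (i : ℕ) : Matrix (Fin 3) (Fin 3) ℝ :=
  !![0, 1, δ; η (i - 2) i ^ 2, η (i - 1) i ^ 2, n₀; 0, 0, 1]

/-- The transmitted noise power at node `n`: the second coordinate of the matrix product
applied to `(0, 0, 1)`. -/
def noisePower (η : ℕ → ℕ → ℝ) (n₀ δ : ℝ) (n : ℕ) : ℝ :=
  (orderedProd (noiseMatrix η n₀ δ) n).mulVec ![0, 0, 1] 1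

/-- The signal-to-noise ratio at node `n`. -/
def snr (η : ℕ → ℕ → ℝ) (I₀ n₀ δ : ℝ) (n : ℕ) : ℝ :=
  signal η I₀ n ^ 2 / noisePower η n₀ δ n

/-- The end-to-end capacity, in nats per channel use. -/
def capacity (η : ℕ → ℕ → ℝ) (I₀ n₀ δ : ℝ) (n : ℕ) : ℝ :=
  Real.log (1 + snr η I₀ n₀ δ n)

section Probability

variable {Ω : Type*} [MeasurableSpace Ω]

/-- The expectation in `[-∞, ∞)` of a real function whose positive part is integrable. -/
def extExpectation (μ : Measure Ω) (f : Ω → ℝ) : EReal :=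
  ((∫⁻ ω, ENNReal.ofReal (f ω) ∂μ : ENNReal) : EReal)
    - ((∫⁻ ω, ENNReal.ofReal (-f ω) ∂μ : ENNReal) : EReal)

open scoped Matrix.Norms.Operator in
/-- The upper Lyapunov exponent `lim (1/n) E log ‖M n ⋯ M 2‖ ∈ [-∞, ∞)` of a product of
i.i.d. random matrices (the limit exists by subadditivity when `E log⁺ ‖M 2‖ < ∞`; it does not
depend on the norm, here the maximal absolute row sum). -/
def upperLyapunovExponent (μ : Measure Ω) {d : ℕ}
    (M : Ω → ℕ → Matrix (Fin d) (Fin d) ℝ) : EReal :=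
  limsup (fun n : ℕ =>
    ((1 / (n : ℝ) : ℝ) : EReal)
      * extExpectation μ (fun ω => Real.log ‖orderedProd (M ω) n‖)) atTop

/-- `f n = O_P(g n)`: with probability tending to one `f n ≤ g n * e ^ h n`, where `h = |o(n)|`
is deterministic. -/
def IsBigOP (μ : Measure Ω) (f : ℕ → Ω → ℝ) (g : ℕ → ℝ) : Prop :=
  ∃ h : ℕ → ℝ, (∀ n, 0 ≤ h n) ∧ (h =o[atTop] fun n : ℕ => (n : ℝ)) ∧
    Tendsto (fun n => μ {ω | f n ω ≤ g n * Real.exp (h n)}) atTop (𝓝 1)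

/-- `f n = Ω_P(g n)`. -/
def IsBigOmegaP (μ : Measure Ω) (f : ℕ → Ω → ℝ) (g : ℕ → ℝ) : Prop :=
  ∃ h : ℕ → ℝ, (∀ n, 0 ≤ h n) ∧ (h =o[atTop] fun n : ℕ => (n : ℝ)) ∧
    Tendsto (fun n => μ {ω | g n * Real.exp (-h n) ≤ f n ω}) atTop (𝓝 1)

/-- `f n = Θ_P(g n)`. -/
def IsThetaP (μ : Measure Ω) (f : ℕ → Ω → ℝ) (g : ℕ → ℝ) : Prop :=
  IsBigOP μ f g ∧ IsBigOmegaP μ f g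

/-- Convergence in probability of real random variables to a constant of the extended line. -/
def TendstoInProbability (μ : Measure Ω) (X : ℕ → Ω → ℝ) (L : EReal) : Prop :=
  ∀ U ∈ 𝓝 L, Tendsto (fun n => μ {ω | (X n ω : EReal) ∈ U}) atTop (𝓝 1)

end Probability

end

end AFRelay

/-!
# Capacity scaling of the cooperative amplify-and-forward relay network

The proof reduces everything to one scalar recursion. The pairs
`z i = (η i (i + 2), η (i + 1) (i + 2))` of gains entering node `i + 2` are i.i.d., and
`linRec z a b` is the solution of `r (n + 2) = (z n).2 * r (n + 1) + (z n).1 * r n` with `r 0 = a`,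
`r 1 = b`. The signal is such a solution, and the norm of the matrix product is
`growth z n = max (r n) (r (n + 1))` for the solution started from `(1, 1)`.

*Reduction.* Write `F k n` for the logarithm of the growth from node `k` to node `n`. The noise
arriving at `n` is a sum over the nodes `k` where it was injected, and since a sum of squares of
nonnegative numbers is at most the square of the sum, the noise injected at `k` arrives with power
at most `n₀ * exp (2 * F k n)`; also the noise power is at least `n₀`. Hence, up to constants,
`c n` is at most `min (n, I n ^ 2)` and at least `min (1, I n ^ 2 / (n * max_k exp (2 * F k n)))`.
If `log (I n) ≈ n λ` and `F k n ≤ (n - k) λ + o(n)` uniformly in `k ≤ n`, both bounds are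
`exp (n * min 0 (2 λ) + o(n))`.

*Upper bounds.* `F` is subadditive, and `F` over disjoint blocks of fixed length is i.i.d. For every
real `L > λ` there is a block length with mean (of a truncation from below, as the mean may be `-∞`)
less than `L` per step, so the strong law of large numbers gives, almost surely,
`F k n ≤ (n - k) L + o(n)` uniformly in `k` (`IsIID.ae_eventually_le`,
`ae_eventually_log_growth_le`).

*Lower bound in probability.* If `λ > -∞`, all `F 0 n` are integrable with mean at least `n λ` by
Fekete's lemma. The deficit of `F 0 n / n` below the average `S n / n` of the one-step bounds is
nonnegative, its mean is at most `u = E F 0 1 - λ`, and by the upper bound it is almost surely at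
least `u - o(1)`; so it tends to `u` in probability, which is `F 0 n / n → λ`
(`tendsto_measure_log_growth_lt`). The signal is smaller than the norm of the product by a factor
whose law does not depend on `n` (`tendsto_measure_log_linRec_lt`).

*Almost sure lower bound.* If `log η` is integrable, then `-log` of the supermultiplicative
`pathWeight z n`, the solution from `(0, 1)`, is subadditive and integrable, its mean exceeds
`-E F 0 n` by at most a bounded amount, and the same block argument applies
(`ae_eventually_exp_le_linRec`).
-/

namespace AFRelay

/-! ### Linear recursions with positive coefficients, and the relay network -/

/-- The solution of `r (n + 2) = (z n).2 * r (n + 1) + (z n).1 * r n` with `r 0 = a`, `r 1 = b`. -/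
def linRec (z : ℕ → ℝ × ℝ) (a b : ℝ) : ℕ → ℝ
  | 0 => a
  | 1 => b
  | n + 2 => (z n).2 * linRec z a b (n + 1) + (z n).1 * linRec z a b n

/-- The sequence `z` read from index `k` on. -/
def shift {E : Type*} (k : ℕ) (z : ℕ → E) : ℕ → E := fun i => z (k + i)

/-- All coefficients of the recursion are strictly positive. -/
def PosSeq (z : ℕ → ℝ × ℝ) : Prop := ∀ i, 0 < (z i).1 ∧ 0 < (z i).2

theorem PosSeq.shift {z : ℕ → ℝ × ℝ} (hz : PosSeq z) (k : ℕ) : PosSeq (shift k z) :=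
  fun i => hz (k + i)

theorem shift_shift {E : Type*} (k l : ℕ) (z : ℕ → E) : shift l (shift k z) = shift (k + l) z := by
  funext i
  simp [shift, add_assoc]

@[simp] theorem shift_zero {E : Type*} (z : ℕ → E) : shift 0 z = z := by
  funext i
  simp [shift]

theorem linRec_nonneg {z : ℕ → ℝ × ℝ} (hz : PosSeq z) {a b : ℝ} (ha : 0 ≤ a) (hb : 0 ≤ b) (n : ℕ) :
    0 ≤ linRec z a b n := by
  induction n using Nat.twoStepInduction with
  | zero => exact ha
  | one => exact hb
  | more n h0 h1 =>
    rw [linRec]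
    have := hz n
    nlinarith [mul_nonneg this.2.le h1, mul_nonneg this.1.le h0]

theorem linRec_sub (z : ℕ → ℝ × ℝ) (a b a' b' : ℝ) (n : ℕ) :
    linRec z (a - a') (b - b') n = linRec z a b n - linRec z a' b' n := by
  induction n using Nat.twoStepInduction with
  | zero => rfl
  | one => rfl
  | more n h0 h1 => rw [linRec, linRec, linRec, h0, h1]; ring

theorem linRec_mono {z : ℕ → ℝ × ℝ} (hz : PosSeq z) {a b a' b' : ℝ} (ha : a ≤ a') (hb : b ≤ b')
    (n : ℕ) : linRec z a b n ≤ linRec z a' b' n := by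
  have := linRec_nonneg hz (sub_nonneg.2 ha) (sub_nonneg.2 hb) n
  rw [linRec_sub] at this
  linarith

theorem linRec_mul (z : ℕ → ℝ × ℝ) (c a b : ℝ) (n : ℕ) :
    linRec z (c * a) (c * b) n = c * linRec z a b n := by
  induction n using Nat.twoStepInduction with
  | zero => rfl
  | one => rfl
  | more n h0 h1 => rw [linRec, linRec, h0, h1]; ring

theorem linRec_pos {z : ℕ → ℝ × ℝ} (hz : PosSeq z) {a b : ℝ} (ha : 0 < a) (hb : 0 < b) (n : ℕ) :
    0 < linRec z a b n := by
  induction n using Nat.twoStepInduction with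
  | zero => exact ha
  | one => exact hb
  | more n h0 h1 =>
    rw [linRec]
    exact add_pos (mul_pos (hz n).2 h1) (mul_pos (hz n).1 h0)

/-- Restarting the recursion at step `k`; all the (sub/super)multiplicativity below is monotonicity
applied to this identity. -/
theorem linRec_add (z : ℕ → ℝ × ℝ) (a b : ℝ) (k n : ℕ) :
    linRec z a b (k + n) = linRec (shift k z) (linRec z a b k) (linRec z a b (k + 1)) n := by
  induction n using Nat.twoStepInduction with
  | zero => rfl
  | one => rfl
  | more n h0 h1 =>
    rw [← add_assoc, linRec, linRec, ← h0, ← h1, shift, add_assoc]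

theorem linRec_le_max {z : ℕ → ℝ × ℝ} (hz : PosSeq z) (a b : ℝ) (n : ℕ) :
    linRec z a b n ≤ max a b * linRec z 1 1 n := by
  rw [← linRec_mul, mul_one]
  exact linRec_mono hz (le_max_left _ _) (le_max_right _ _) n

theorem min_mul_linRec_le {z : ℕ → ℝ × ℝ} (hz : PosSeq z) (a b : ℝ) (n : ℕ) :
    min a b * linRec z 1 1 n ≤ linRec z a b n := by
  rw [← linRec_mul, mul_one]
  exact linRec_mono hz (min_le_left _ _) (min_le_right _ _) n

theorem linRec_congr {z z' : ℕ → ℝ × ℝ} (a b : ℝ) {n : ℕ} (h : ∀ i, i + 2 ≤ n → z i = z' i) :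
    linRec z a b n = linRec z' a b n := by
  induction n using Nat.twoStepInduction with
  | zero => rfl
  | one => rfl
  | more n h0 h1 =>
    rw [linRec, linRec, h0 fun i hi => h i (by omega), h1 fun i hi => h i (by omega),
      h n le_rfl]

theorem measurable_linRec (a b : ℝ) (n : ℕ) : Measurable fun z => linRec z a b n := by
  induction n using Nat.twoStepInduction with
  | zero => exact measurable_const
  | one => exact measurable_const
  | more n h0 h1 => simp only [linRec]; fun_prop

/-- The growth of the recursion after `n` steps: the maximal absolute row sum of the product of `n`
transfer matrices, see `norm_orderedProd_infoMatrix`. -/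
noncomputable def growth (z : ℕ → ℝ × ℝ) (n : ℕ) : ℝ := max (linRec z 1 1 n) (linRec z 1 1 (n + 1))

theorem growth_pos {z : ℕ → ℝ × ℝ} (hz : PosSeq z) (n : ℕ) : 0 < growth z n :=
  (linRec_pos hz one_pos one_pos n).trans_le (le_max_left _ _)

theorem growth_zero (z : ℕ → ℝ × ℝ) : growth z 0 = 1 := by simp [growth, linRec]

theorem growth_one (z : ℕ → ℝ × ℝ) : growth z 1 = max 1 ((z 0).2 + (z 0).1) := by
  simp [growth, linRec]

theorem growth_add_le {z : ℕ → ℝ × ℝ} (hz : PosSeq z) (a b : ℕ) :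
    growth z (a + b) ≤ growth z a * growth (shift a z) b := by
  have key : ∀ n, linRec z 1 1 (a + n) ≤ growth z a * linRec (shift a z) 1 1 n := fun n => by
    rw [linRec_add]
    exact linRec_le_max (hz.shift a) _ _ n
  have h := (growth_pos hz a).le
  refine max_le ((key b).trans ?_) ((key (b + 1)).trans ?_)
  · exact mul_le_mul_of_nonneg_left (le_max_left _ _) h
  · exact mul_le_mul_of_nonneg_left (le_max_right _ _) h

theorem growth_congr {z z' : ℕ → ℝ × ℝ} {n : ℕ} (h : ∀ i < n, z i = z' i) :
    growth z n = growth z' n := by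
  rw [growth, growth, linRec_congr 1 1 fun i hi => h i (by omega),
    linRec_congr 1 1 fun i hi => h i (by omega)]

theorem measurable_growth (n : ℕ) : Measurable fun z => growth z n :=
  (measurable_linRec 1 1 n).max (measurable_linRec 1 1 (n + 1))

/-- The state vector is comparable with its second coordinate alone, at the price of one inverse
gain. -/
theorem growth_le_linRec {z : ℕ → ℝ × ℝ} (hz : PosSeq z) (n : ℕ) :
    growth z (n + 1) ≤ (1 + (z n).2⁻¹) * linRec z 1 1 (n + 2) := by
  have hq := (hz n).2
  have hp := (hz n).1
  have h0 := linRec_pos hz one_pos one_pos n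
  have h1 := linRec_pos hz one_pos one_pos (n + 1)
  have h2 := linRec_pos hz one_pos one_pos (n + 2)
  have hinv := inv_pos.2 hq
  refine max_le ?_ ?_
  · have : (z n).2 * linRec z 1 1 (n + 1) ≤ linRec z 1 1 (n + 2) := by
      rw [linRec]; nlinarith [mul_pos hp h0]
    calc linRec z 1 1 (n + 1) = (z n).2⁻¹ * ((z n).2 * linRec z 1 1 (n + 1)) := by field_simp
      _ ≤ (z n).2⁻¹ * linRec z 1 1 (n + 2) := by gcongr
      _ ≤ _ := by nlinarith
  · nlinarith [mul_pos hinv h2]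

/-- The total weight of the paths from node `1` to node `n + 1`, the weight of a path being the
product of its gains. -/
noncomputable def pathWeight (z : ℕ → ℝ × ℝ) (n : ℕ) : ℝ := linRec z 0 1 (n + 1)

theorem pathWeight_zero (z : ℕ → ℝ × ℝ) : pathWeight z 0 = 1 := rfl

theorem pathWeight_one (z : ℕ → ℝ × ℝ) : pathWeight z 1 = (z 0).2 := by
  simp [pathWeight, linRec]

theorem mul_pathWeight_le_add {z : ℕ → ℝ × ℝ} (hz : PosSeq z) (a b : ℕ) :
    pathWeight z a * pathWeight (shift a z) b ≤ pathWeight z (a + b) := by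
  have h := linRec_mono (hz.shift a) (linRec_nonneg hz le_rfl zero_le_one a)
    (le_refl (linRec z 0 1 (a + 1))) (b + 1)
  rw [← linRec_add] at h
  calc pathWeight z a * pathWeight (shift a z) b
      = linRec (shift a z) 0 (linRec z 0 1 (a + 1)) (b + 1) := by
        rw [pathWeight, pathWeight, ← linRec_mul, mul_zero, mul_one]
    _ ≤ _ := h

theorem pathWeight_pos {z : ℕ → ℝ × ℝ} (hz : PosSeq z) (n : ℕ) : 0 < pathWeight z n := by
  induction n with
  | zero => exact one_pos
  | succ n ih =>
    refine lt_of_lt_of_le ?_ (mul_pathWeight_le_add hz n 1)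
    rw [pathWeight_one]
    exact mul_pos ih ((hz.shift n) 0).2

theorem pathWeight_congr {z z' : ℕ → ℝ × ℝ} {n : ℕ} (h : ∀ i < n, z i = z' i) :
    pathWeight z n = pathWeight z' n :=
  linRec_congr 0 1 fun i hi => h i (by omega)

theorem measurable_pathWeight (n : ℕ) : Measurable fun z => pathWeight z n :=
  measurable_linRec 0 1 (n + 1)

theorem pathWeight_le_growth {z : ℕ → ℝ × ℝ} (hz : PosSeq z) (n : ℕ) :
    pathWeight z n ≤ growth z n :=
  (linRec_mono hz zero_le_one le_rfl (n + 1)).trans (le_max_right _ _)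

theorem pathWeight_le_linRec {z : ℕ → ℝ × ℝ} (hz : PosSeq z) (n : ℕ) :
    pathWeight z n ≤ linRec z 1 1 (n + 1) :=
  linRec_mono hz zero_le_one le_rfl (n + 1)

/-- The supermultiplicative path weight controls the growth, at the price of two inverse gains whose
laws do not depend on `n`. -/
theorem growth_shift_le_pathWeight {z : ℕ → ℝ × ℝ} (hz : PosSeq z) (n : ℕ) :
    growth (shift 1 z) (n + 1) ≤
      (1 + (z (1 + n)).2⁻¹) * ((1 + (z 0).2⁻¹) * pathWeight z (n + 2)) := by
  have h1 : pathWeight z (n + 2) = linRec (shift 1 z) 1 (z 0).2 (n + 2) := by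
    rw [pathWeight, show n + 2 + 1 = 1 + (n + 2) by omega, linRec_add]
    simp [linRec]
  have hq := (hz 0).2
  have h2 : linRec (shift 1 z) 1 1 (n + 2) ≤ (1 + (z 0).2⁻¹) * pathWeight z (n + 2) := by
    rw [h1, ← linRec_mul]
    have := inv_pos.2 hq
    refine linRec_mono (hz.shift 1) (by linarith) ?_ _
    rw [add_mul, inv_mul_cancel₀ hq.ne']
    linarith
  refine (growth_le_linRec (hz.shift 1) n).trans ?_
  have := inv_pos.2 ((hz.shift 1) n).2
  exact mul_le_mul_of_nonneg_left h2 (by linarith)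

/-- The gains `(η i (i + 2), η (i + 1) (i + 2))` of the two links entering node `i + 2`. Different
indices use disjoint sets of links; the link `(0, 1)` is left out. -/
def inLinks (e : ℕ → ℕ → ℝ) : ℕ → ℝ × ℝ := fun i => (e i (i + 2), e (i + 1) (i + 2))

theorem signal_eq_linRec (e : ℕ → ℕ → ℝ) (I₀ : ℝ) (n : ℕ) :
    signal e I₀ n = linRec (inLinks e) I₀ (e 0 1 * I₀) n := by
  induction n using Nat.twoStepInduction with
  | zero => rfl
  | one => rfl
  | more n h0 h1 => rw [signal, linRec, h0, h1, inLinks]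

theorem orderedProd_infoMatrix (e : ℕ → ℕ → ℝ) (n : ℕ) :
    orderedProd (infoMatrix e) (n + 1) =
      !![linRec (inLinks e) 1 0 n, linRec (inLinks e) 0 1 n;
        linRec (inLinks e) 1 0 (n + 1), linRec (inLinks e) 0 1 (n + 1)] := by
  induction n with
  | zero => simp [orderedProd, linRec, Matrix.one_fin_two]
  | succ n ih =>
    rw [orderedProd, ih, infoMatrix, Matrix.mul_fin_two]
    simp [linRec, inLinks, add_comm]

open scoped Matrix.Norms.Operator in
theorem norm_orderedProd_infoMatrix (e : ℕ → ℕ → ℝ) (he : PosSeq (inLinks e)) (n : ℕ) :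
    ‖orderedProd (infoMatrix e) (n + 1)‖ = growth (inLinks e) n := by
  have key : ∀ m, |linRec (inLinks e) 1 0 m| + |linRec (inLinks e) 0 1 m|
      = linRec (inLinks e) 1 1 m := fun m => by
    rw [abs_of_nonneg (linRec_nonneg he zero_le_one le_rfl m),
      abs_of_nonneg (linRec_nonneg he le_rfl zero_le_one m)]
    have := linRec_sub (inLinks e) 1 1 0 1 m
    norm_num at this
    linarith
  rw [orderedProd_infoMatrix, Matrix.linfty_opNorm_def, growth, ← key, ← key]
  simp [Fin.univ_succ]

/-- The noise state is bounded by the sum over the injection times `k + 1` of the squared signal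
growth from there: the injected `(δ, n₀)` is at most `n₀ * (1, 1)`, and a sum of squares of
nonnegative numbers is at most the square of the sum. -/
theorem noise_bounds (e : ℕ → ℕ → ℝ) (he : PosSeq (inLinks e)) {n₀ δ : ℝ} (hn₀ : 0 < n₀)
    (hδ0 : 0 ≤ δ) (hδ : δ ≤ n₀) (n : ℕ) :
    ∃ x y : ℝ, (orderedProd (noiseMatrix e n₀ δ) (n + 1)).mulVec ![0, 0, 1] = ![x, y, 1] ∧
      0 ≤ x ∧ 0 ≤ y ∧ (1 ≤ n → n₀ ≤ y) ∧
      x ≤ n₀ * ∑ k ∈ Finset.range n,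
        linRec (shift (k + 1) (inLinks e)) 1 1 (n - (k + 1)) ^ 2 ∧
      y ≤ n₀ * ∑ k ∈ Finset.range n,
        linRec (shift (k + 1) (inLinks e)) 1 1 (n + 1 - (k + 1)) ^ 2 := by
  induction n with
  | zero => exact ⟨0, 0, by simp [orderedProd]⟩
  | succ n ih =>
    obtain ⟨x, y, hxy, hx0, hy0, -, hx, hy⟩ := ih
    have hp := (he n).1
    have hq := (he n).2
    refine ⟨y + δ, (inLinks e n).1 ^ 2 * x + (inLinks e n).2 ^ 2 * y + n₀, ?_, by linarith,
      by positivity, fun _ => le_add_of_nonneg_left (by positivity), ?_, ?_⟩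
    · rw [orderedProd, ← Matrix.mulVec_mulVec, hxy]
      ext i
      fin_cases i <;>
        simp [noiseMatrix, Matrix.mulVec, dotProduct, Fin.sum_univ_three, inLinks]
    · rw [Finset.sum_range_succ, mul_add]
      simp only [Nat.sub_self, linRec]
      linarith
    · rw [Finset.sum_range_succ, mul_add, show n + 1 + 1 - (n + 1) = 1 by omega]
      have key : ∀ k ∈ Finset.range n,
          (inLinks e n).1 ^ 2 * linRec (shift (k + 1) (inLinks e)) 1 1 (n - (k + 1)) ^ 2
          + (inLinks e n).2 ^ 2 * linRec (shift (k + 1) (inLinks e)) 1 1 (n + 1 - (k + 1)) ^ 2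
          ≤ linRec (shift (k + 1) (inLinks e)) 1 1 (n + 1 + 1 - (k + 1)) ^ 2 := fun k hk => by
        obtain ⟨j, rfl⟩ := Nat.exists_eq_add_of_lt (Finset.mem_range.1 hk)
        rw [show k + j + 1 - (k + 1) = j by omega, show k + j + 1 + 1 - (k + 1) = j + 1 by omega,
          show k + j + 1 + 1 + 1 - (k + 1) = j + 2 by omega, linRec]
        have hs : shift (k + 1) (inLinks e) j = inLinks e (k + j + 1) := by
          rw [shift]; congr 1; omega
        rw [hs]
        have h0 := linRec_nonneg (he.shift (k + 1)) zero_le_one zero_le_one j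
        have h1 := linRec_nonneg (he.shift (k + 1)) zero_le_one zero_le_one (j + 1)
        nlinarith [mul_nonneg (mul_nonneg hp.le h0) (mul_nonneg hq.le h1)]
      have hsum := Finset.sum_le_sum key
      rw [Finset.sum_add_distrib, ← Finset.mul_sum, ← Finset.mul_sum] at hsum
      have h1 := mul_le_mul_of_nonneg_left hx (sq_nonneg (inLinks e n).1)
      have h2 := mul_le_mul_of_nonneg_left hy (sq_nonneg (inLinks e n).2)
      have h3 := mul_le_mul_of_nonneg_left hsum hn₀.le
      simp only [linRec]
      nlinarith

theorem le_noisePower (e : ℕ → ℕ → ℝ) (he : PosSeq (inLinks e)) {n₀ δ : ℝ} (hn₀ : 0 < n₀)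
    (hδ0 : 0 ≤ δ) (hδ : δ ≤ n₀) {n : ℕ} (hn : 2 ≤ n) : n₀ ≤ noisePower e n₀ δ n := by
  obtain ⟨m, rfl⟩ := Nat.exists_eq_add_of_le' hn
  obtain ⟨x, y, hxy, -, -, hy, -⟩ := noise_bounds e he hn₀ hδ0 hδ (m + 1)
  rw [noisePower, hxy]
  exact hy (by omega)

theorem noisePower_le (e : ℕ → ℕ → ℝ) (he : PosSeq (inLinks e)) {n₀ δ : ℝ} (hn₀ : 0 < n₀)
    (hδ0 : 0 ≤ δ) (hδ : δ ≤ n₀) (n : ℕ) {C : ℝ} 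
    (hC : ∀ k ≤ n, growth (shift k (inLinks e)) (n - k) ^ 2 ≤ C) :
    noisePower e n₀ δ n ≤ n₀ * (n * C) := by
  have hC0 : 0 ≤ C := (sq_nonneg _).trans (hC n le_rfl)
  rcases n with _ | n
  · simp [noisePower, orderedProd]
  obtain ⟨x, y, hxy, -, -, -, -, hy⟩ := noise_bounds e he hn₀ hδ0 hδ n
  rw [noisePower, hxy]
  refine hy.trans (mul_le_mul_of_nonneg_left ?_ hn₀.le)
  calc _ ≤ ∑ k ∈ Finset.range n, C := by
        refine Finset.sum_le_sum fun k hk => ?_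
        have hk := Finset.mem_range.1 hk
        refine le_trans ?_ (hC (k + 1) (by omega))
        exact pow_le_pow_left₀ (linRec_nonneg (he.shift _) zero_le_one zero_le_one _)
          (le_max_left _ _) 2
    _ ≤ _ := by
      rw [Finset.sum_const, Finset.card_range, nsmul_eq_mul]
      push_cast
      nlinarith

/-! ### Deterministic asymptotics -/

/-- A convergent average `T n / n → z` controls all earlier values at scale `n`. -/
theorem eventually_abs_sub_le_of_tendsto_div {T : ℕ → ℝ} {z : ℝ}
    (hT : Tendsto (fun n : ℕ => T n / n) atTop (𝓝 z)) (hT0 : T 0 = 0) {ε : ℝ} (hε : 0 < ε) :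
    ∀ᶠ n : ℕ in atTop, ∀ k ≤ n, |T k - z * k| ≤ ε * n := by
  obtain ⟨K, hK⟩ := eventually_atTop.1 (Metric.tendsto_nhds.1 hT ε hε)
  have hlarge : ∀ k ≥ K, |T k - z * k| ≤ ε * k := fun k hk => by
    rcases Nat.eq_zero_or_pos k with rfl | hk0
    · simp [hT0]
    have hk0 : (0 : ℝ) < k := Nat.cast_pos.2 hk0
    have h := (hK k hk).le
    rw [Real.dist_eq] at h
    calc |T k - z * k| = |T k / k - z| * k := by
          rw [← abs_of_pos hk0, ← abs_mul, abs_of_pos hk0]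
          congr 1
          field_simp
      _ ≤ ε * k := by gcongr
  have hM : ∀ᶠ n : ℕ in atTop, ∑ k ∈ Finset.range K, |T k - z * k| ≤ ε * n :=
    (tendsto_natCast_atTop_atTop.const_mul_atTop hε).eventually_ge_atTop _
  filter_upwards [hM] with n hn k hkn
  rcases lt_or_ge k K with h | h
  · exact (Finset.single_le_sum (f := fun k : ℕ => |T k - z * k|) (fun _ _ => abs_nonneg _)
      (Finset.mem_range.2 h)).trans hn
  · refine (hlarge k h).trans ?_
    gcongr

theorem le_sub_sum_of_subadditive {H : ℕ → ℕ → ℝ} {W : ℕ → ℝ} {m : ℕ}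
    (hsub : ∀ k j l, k ≤ j → j ≤ l → H k l ≤ H k j + H j l) (hH0 : ∀ k, H k k ≤ 0)
    (hHW : ∀ i, H (i * m) ((i + 1) * m) ≤ W i) {k l : ℕ} (hkl : k ≤ l) :
    H (k * m) (l * m) ≤ ∑ i ∈ Finset.range l, W i - ∑ i ∈ Finset.range k, W i := by
  induction l, hkl using Nat.le_induction with
  | base => simpa using hH0 _
  | succ l hl ih =>
    rw [Finset.sum_range_succ]
    have := hsub (k * m) (l * m) ((l + 1) * m) (by gcongr) (by gcongr; omega)
    linarith [hHW l]

/-- Uniform linear growth of a subadditive array `H`, from the average of `X`, which bounds it over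
the blocks of length `m`, and of `W`, which bounds it over single steps. The interval `[k, l]` is
cut into complete blocks and two pieces shorter than `m`; the average of `W` makes the latter
`o(n)`. -/
theorem eventually_le_of_subadditive {H : ℕ → ℕ → ℝ} {W X : ℕ → ℝ} {m : ℕ} (hm : 0 < m)
    {w x L : ℝ} (hsub : ∀ k j l, k ≤ j → j ≤ l → H k l ≤ H k j + H j l) (hH0 : ∀ k, H k k ≤ 0)
    (hW : ∀ i, 0 ≤ W i) (hHW : ∀ i, H i (i + 1) ≤ W i)
    (hHX : ∀ j, H (j * m) ((j + 1) * m) ≤ X j)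
    (hw : Tendsto (fun n : ℕ => (∑ i ∈ Finset.range n, W i) / n) atTop (𝓝 w))
    (hx : Tendsto (fun n : ℕ => (∑ i ∈ Finset.range n, X i) / n) atTop (𝓝 x))
    (hxL : x ≤ m * L) {ε : ℝ} (hε : 0 < ε) :
    ∀ᶠ n : ℕ in atTop, ∀ k l, k ≤ l → l ≤ n → H k l ≤ L * ((l : ℝ) - k) + ε * n := by
  have hw0 : 0 ≤ w := ge_of_tendsto' hw fun n =>
    div_nonneg (Finset.sum_nonneg fun i _ => hW i) n.cast_nonneg
  have hε8 : 0 < ε / 8 := by positivity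
  have hconst : ∀ᶠ n : ℕ in atTop, 2 * w * m + 2 * m * |L| ≤ ε / 8 * n :=
    (tendsto_natCast_atTop_atTop.const_mul_atTop hε8).eventually_ge_atTop _
  filter_upwards [eventually_abs_sub_le_of_tendsto_div hw (by simp) hε8,
    eventually_abs_sub_le_of_tendsto_div hx (by simp) hε8, hconst] with n hT hS hc k l hkl hln
  have hWb : ∀ {i j : ℕ}, i ≤ j → j ≤ n → H i j ≤ w * ((j : ℝ) - i) + ε / 4 * n := by
    intro i j hij hj
    have h := le_sub_sum_of_subadditive (W := W) (m := 1) hsub hH0 (by simpa using hHW) hij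
    simp only [mul_one] at h
    have h1 := abs_le.1 (hT i (hij.trans hj))
    have h2 := abs_le.1 (hT j hj)
    linarith
  have hm1 : (1 : ℝ) ≤ m := by exact_mod_cast hm
  have hLabs := neg_abs_le L
  have hLabs' := le_abs_self L
  have hL0 := abs_nonneg L
  have hn0 : 0 ≤ ε / 8 * n := by positivity
  rcases le_or_gt (k / m + 1) (l / m) with hab | hab
  · set a := k / m + 1 with ha
    set b := l / m with hb
    have ha1 : k ≤ a * m := by
      have := Nat.lt_div_mul_add (a := k) hm; rw [ha, add_mul]; omega
    have ha2 : a * m ≤ k + m := by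
      have := Nat.div_mul_le_self k m; rw [ha, add_mul]; omega
    have hb1 : b * m ≤ l := Nat.div_mul_le_self l m
    have hb2 : l ≤ b * m + m := (Nat.lt_div_mul_add (a := l) hm).le
    have hab' : a * m ≤ b * m := by gcongr
    have hbn : b ≤ n := (Nat.div_le_self l m).trans hln
    have h1 := hsub k (a * m) l ha1 (hab'.trans hb1)
    have h2 := hsub (a * m) (b * m) l hab' hb1
    have h3 := hWb ha1 (hab'.trans (hb1.trans hln))
    have h4 := hWb hb1 hln
    have h5 := le_sub_sum_of_subadditive hsub hH0 hHX hab
    have h6 := abs_le.1 (hS a (hab.trans hbn))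
    have h7 := abs_le.1 (hS b hbn)
    have ha1' : (k : ℝ) ≤ a * m := by exact_mod_cast ha1
    have ha2' : (a : ℝ) * m ≤ k + m := by exact_mod_cast ha2
    have hb1' : (b : ℝ) * m ≤ l := by exact_mod_cast hb1
    have hb2' : (l : ℝ) ≤ b * m + m := by exact_mod_cast hb2
    have habr : (0 : ℝ) ≤ (b : ℝ) - a := sub_nonneg.2 (by exact_mod_cast hab)
    push_cast at h3 h4
    have h8 : x * ((b : ℝ) - a) ≤ L * ((b : ℝ) * m - a * m) := by
      have := mul_le_mul_of_nonneg_right hxL habr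
      linarith
    have h9 : L * ((b : ℝ) * m - a * m) - L * ((l : ℝ) - k) ≤ 2 * m * |L| := by
      have h : L * (((b : ℝ) * m - l) + (k - a * m)) ≤ |L| * (2 * m) := by
        calc _ ≤ |L * (((b : ℝ) * m - l) + (k - a * m))| := le_abs_self _
          _ = |L| * |((b : ℝ) * m - l) + (k - a * m)| := abs_mul _ _
          _ ≤ _ := by
            gcongr
            exact abs_le.2 ⟨by linarith, by linarith⟩
      linarith
    have h10 : w * ((a : ℝ) * m - k) ≤ w * m := by gcongr; linarith
    have h11 : w * ((l : ℝ) - b * m) ≤ w * m := by gcongr; linarith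
    linarith
  · have hlk : l ≤ k + m := by
      have h1 := Nat.lt_div_mul_add (a := l) hm
      have h2 := Nat.div_mul_le_self k m
      have h3 : l / m * m ≤ k / m * m := Nat.mul_le_mul_right m (by omega)
      omega
    have hlk' : (l : ℝ) ≤ k + m := by exact_mod_cast hlk
    have hkl' : (k : ℝ) ≤ l := by exact_mod_cast hkl
    have h1 := hWb hkl hln
    have h2 : w * ((l : ℝ) - k) ≤ w * m := by gcongr; linarith
    have h3 : -(L * ((l : ℝ) - k)) ≤ |L| * m := by
      rw [← neg_mul]
      exact mul_le_mul (neg_le_abs L) (by linarith) (by linarith) hL0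
    have h4 : 0 ≤ w * m := by positivity
    have h5 : 0 ≤ |L| * m := by positivity
    linarith

theorem half_min_one_le_log_one_add {x : ℝ} (hx : 0 ≤ x) : min x 1 / 2 ≤ Real.log (1 + x) := by
  have h := Real.one_sub_inv_le_log_of_pos (by linarith : 0 < 1 + x)
  refine le_trans ?_ h
  have h1 : 1 - (1 + x)⁻¹ = x / (1 + x) := by field_simp; ring
  rw [h1, div_le_div_iff₀ two_pos (by linarith)]
  rcases le_total x 1 with h2 | h2
  · rw [min_eq_left h2]; nlinarith
  · rw [min_eq_right h2]; nlinarith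

theorem eventually_add_mul_le_exp (a b : ℝ) {ε : ℝ} (hε : 0 < ε) :
    ∀ᶠ n : ℕ in atTop, a + b * n ≤ Real.exp (n * ε) := by
  have h : Tendsto (fun n : ℕ => (n : ℝ) * ε) atTop atTop :=
    tendsto_natCast_atTop_atTop.atTop_mul_const hε
  have h1 := (Real.tendsto_exp_div_pow_atTop 1).comp h |>.eventually_ge_atTop ((|a| + |b|) / ε)
  filter_upwards [h1, eventually_ge_atTop 1] with n hn hn1
  have hn1 : (1 : ℝ) ≤ n := by exact_mod_cast hn1
  simp only [Function.comp, pow_one] at hn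
  rw [div_le_div_iff₀ hε (by positivity)] at hn
  have h2 : (|a| + |b|) * n ≤ Real.exp (n * ε) := by
    refine le_of_mul_le_mul_right ?_ hε
    linarith
  nlinarith [le_abs_self a, le_abs_self b, abs_nonneg a]

section capacity

variable {e : ℕ → ℕ → ℝ} {I₀ n₀ δ : ℝ}

theorem snr_pos (he : PosSeq (inLinks e)) (he01 : 0 < e 0 1) (hI₀ : 0 < I₀) (hn₀ : 0 < n₀)
    (hδ0 : 0 ≤ δ) (hδ : δ ≤ n₀) {n : ℕ} (hn : 2 ≤ n) : 0 < snr e I₀ n₀ δ n := by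
  have h1 : 0 < signal e I₀ n := by
    rw [signal_eq_linRec]
    exact linRec_pos he hI₀ (mul_pos he01 hI₀) n
  have h2 := hn₀.trans_le (le_noisePower e he hn₀ hδ0 hδ hn)
  exact div_pos (pow_pos h1 2) h2

/-- Upper bound for the capacity: `log (1 + γ)` is at most `γ ≤ I n ^ 2 / n₀`, and it grows at most
linearly when `I n` grows exponentially. -/
theorem eventually_capacity_le (he : PosSeq (inLinks e)) (he01 : 0 < e 0 1) (hI₀ : 0 < I₀)
    (hn₀ : 0 < n₀) (hδ0 : 0 ≤ δ) (hδ : δ ≤ n₀) {L ε : ℝ} (hε : 0 < ε)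
    (h : ∀ᶠ n : ℕ in atTop, Real.log (growth (inLinks e) n) ≤ L * n + ε * n) :
    ∀ᶠ n : ℕ in atTop, 0 < capacity e I₀ n₀ δ n ∧
      capacity e I₀ n₀ δ n ≤ Real.exp (n * (min 0 (2 * L) + 3 * ε)) := by
  set A := max I₀ (e 0 1 * I₀) ^ 2 / n₀ with hA
  have hA0 : 0 ≤ A := by positivity
  filter_upwards [h, eventually_ge_atTop 2, eventually_add_mul_le_exp A 0 hε,
    eventually_add_mul_le_exp (Real.log (1 + A)) (2 * |L| + 2 * ε)
      (by positivity : 0 < 3 * ε)] with n hn hn2 h1 h2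
  have hs := snr_pos he he01 hI₀ hn₀ hδ0 hδ hn2
  have hN := le_noisePower e he hn₀ hδ0 hδ hn2
  refine ⟨Real.log_pos (by linarith), ?_⟩
  have hg : growth (inLinks e) n ≤ Real.exp (L * n + ε * n) :=
    (Real.log_le_iff_le_exp (growth_pos he n)).1 hn
  have hsig : signal e I₀ n ≤ max I₀ (e 0 1 * I₀) * Real.exp (L * n + ε * n) := by
    rw [signal_eq_linRec]
    refine (linRec_le_max he _ _ n).trans ?_
    exact mul_le_mul_of_nonneg_left ((le_max_left _ _).trans hg) (hI₀.le.trans (le_max_left _ _))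
  have hsig0 : 0 ≤ signal e I₀ n := by
    rw [signal_eq_linRec]
    exact (linRec_pos he hI₀ (mul_pos he01 hI₀) n).le
  have hsnr : snr e I₀ n₀ δ n ≤ A * Real.exp (n * (2 * L + 2 * ε)) := by
    calc snr e I₀ n₀ δ n
        ≤ (max I₀ (e 0 1 * I₀) * Real.exp (L * n + ε * n)) ^ 2 / n₀ := by
          rw [snr]; gcongr
      _ = A * Real.exp (n * (2 * L + 2 * ε)) := by
        rw [hA, mul_pow, ← Real.exp_nat_mul, div_mul_eq_mul_div]
        congr 3
        push_cast; ring
  have hexp : ∀ x : ℝ, Real.exp (n * (x + 3 * ε)) = Real.exp (n * ε) * Real.exp (n * (x + 2 * ε)) :=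
    fun x => by rw [← Real.exp_add]; congr 1; ring
  rw [capacity]
  rcases le_total (2 * L) 0 with hL | hL
  · rw [min_eq_right hL, hexp]
    calc Real.log (1 + snr e I₀ n₀ δ n) ≤ snr e I₀ n₀ δ n := by
          have := Real.log_le_sub_one_of_pos (by linarith : 0 < 1 + snr e I₀ n₀ δ n)
          linarith
      _ ≤ _ := hsnr.trans (by gcongr; simpa using h1)
  · rw [min_eq_left hL, zero_add]
    refine le_trans ?_ h2
    have hexp1 : 1 ≤ Real.exp (n * (2 * |L| + 2 * ε)) := Real.one_le_exp (by positivity)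
    calc Real.log (1 + snr e I₀ n₀ δ n)
        ≤ Real.log ((1 + A) * Real.exp (n * (2 * |L| + 2 * ε))) := by
          refine Real.log_le_log (by linarith) ?_
          have : A * Real.exp (n * (2 * L + 2 * ε)) ≤ A * Real.exp (n * (2 * |L| + 2 * ε)) := by
            gcongr; exact le_abs_self L
          linarith
      _ = _ := by
        rw [Real.log_mul (by positivity) (by positivity), Real.log_exp]; ring

/-- Lower bound for the capacity from a lower bound for the signal and upper bounds for the growth
from every intermediate node. The last two hypotheses say that `n` is so large that constants and
the number of noise sources are absorbed. -/
theorem le_capacity (he : PosSeq (inLinks e)) (hn₀ : 0 < n₀) (hδ0 : 0 ≤ δ) (hδ : δ ≤ n₀)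
    {l L ε : ℝ} (hε : 0 < ε) {n : ℕ} (hn : 2 ≤ n)
    (hsig : Real.exp (n * (l - ε)) ≤ signal e I₀ n)
    (hg : ∀ k ≤ n, Real.log (growth (shift k (inLinks e)) (n - k)) ≤ L * ((n : ℝ) - k) + ε * n)
    (h2 : 2 ≤ Real.exp (n * ε)) (hn₂ : 2 * n₀ * n ≤ Real.exp (n * ε)) :
    Real.exp (n * (min 0 (2 * l - 2 * max 0 L) - 5 * ε)) ≤ capacity e I₀ n₀ δ n := by
  have hn1 : (0 : ℝ) < n := by positivity
  have hN0 := le_noisePower e he hn₀ hδ0 hδ hn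
  have hN := noisePower_le e he hn₀ hδ0 hδ n
      (C := Real.exp (n * (2 * max 0 L + 2 * ε))) fun k hk => by
    have hk' : (k : ℝ) ≤ n := by exact_mod_cast hk
    have h1 := (Real.log_le_iff_le_exp (growth_pos (he.shift k) (n - k))).1 (hg k hk)
    calc _ ≤ Real.exp (L * ((n : ℝ) - k) + ε * n) ^ 2 := by
          gcongr; exact (growth_pos (he.shift k) _).le
      _ = Real.exp (2 * (L * ((n : ℝ) - k) + ε * n)) := by rw [← Real.exp_nat_mul]; norm_num
      _ ≤ _ := by
        refine Real.exp_le_exp.2 ?_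
        have : L * ((n : ℝ) - k) ≤ max 0 L * n := by
          calc _ ≤ max 0 L * ((n : ℝ) - k) :=
                mul_le_mul_of_nonneg_right (le_max_right _ _) (by linarith)
            _ ≤ _ := mul_le_mul_of_nonneg_left (by linarith [k.cast_nonneg (α := ℝ)])
                (le_max_left _ _)
        linarith
  have hsnr : 2 * Real.exp (n * (2 * l - 2 * max 0 L - 5 * ε)) ≤ snr e I₀ n₀ δ n := by
    rw [snr, le_div_iff₀ (by linarith)]
    calc _ ≤ 2 * Real.exp (n * (2 * l - 2 * max 0 L - 5 * ε))
          * (n₀ * (n * Real.exp (n * (2 * max 0 L + 2 * ε)))) := by gcongr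
      _ = (2 * n₀ * n) * (Real.exp (n * (2 * l - 2 * max 0 L - 5 * ε))
          * Real.exp (n * (2 * max 0 L + 2 * ε))) := by ring
      _ ≤ Real.exp (n * ε) * (Real.exp (n * (2 * l - 2 * max 0 L - 5 * ε))
          * Real.exp (n * (2 * max 0 L + 2 * ε))) := by gcongr
      _ = Real.exp (n * (l - ε)) ^ 2 := by
        rw [← Real.exp_add, ← Real.exp_add, ← Real.exp_nat_mul]
        congr 1
        push_cast; ring
      _ ≤ _ := by gcongr
  have hs0 : 0 ≤ snr e I₀ n₀ δ n := le_trans (by positivity) hsnr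
  refine le_trans ?_ (half_min_one_le_log_one_add hs0)
  rw [le_div_iff₀ two_pos, mul_comm]
  refine le_min (le_trans ?_ hsnr) ?_
  · gcongr
    exact min_le_right _ _
  · calc _ ≤ Real.exp (n * ε) * Real.exp (n * (0 - 5 * ε)) := by
          gcongr
          exact min_le_left _ _
      _ = Real.exp (-(4 * (n * ε))) := by rw [← Real.exp_add]; congr 1; ring
      _ ≤ 1 := Real.exp_le_one_iff.2 (by have : 0 < n * ε := by positivity
                                         linarith)

end capacity

/-! ### Independent identically distributed sequences and block averages -/

section iid

variable {Ω E : Type*} [MeasurableSpace Ω] [MeasurableSpace E] {μ : Measure Ω}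

theorem measurable_shift (k : ℕ) : Measurable (shift k : (ℕ → E) → ℕ → E) :=
  measurable_pi_lambda _ fun i => measurable_pi_apply (k + i)

/-- The coordinates of the random sequence `ζ` are independent and identically distributed. -/
structure IsIID (ζ : Ω → ℕ → E) (μ : Measure Ω) : Prop where
  measurable : Measurable ζ
  indep : iIndepFun (fun i ω => ζ ω i) μ
  ident : ∀ i, IdentDistrib (fun ω => ζ ω i) (fun ω => ζ ω 0) μ μ

namespace IsIID

variable {ζ : Ω → ℕ → E}

theorem identDistrib_shift (hζ : IsIID ζ μ) (k : ℕ) :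
    IdentDistrib (fun ω => shift k (ζ ω)) ζ μ μ :=
  IdentDistrib.pi (X := fun i ω => ζ ω (k + i)) (Y := fun i ω => ζ ω i)
    (fun i => (hζ.ident (k + i)).trans (hζ.ident i).symm)
    (hζ.indep.precomp (add_right_injective k)) hζ.indep

theorem identDistrib_comp_shift (hζ : IsIID ζ μ) {Ψ : (ℕ → E) → ℝ} (hΨ : Measurable Ψ) (k : ℕ) :
    IdentDistrib (fun ω => Ψ (shift k (ζ ω))) (fun ω => Ψ (ζ ω)) μ μ :=
  (hζ.identDistrib_shift k).comp hΨ

/-- The strong law of large numbers for a functional of the first `m` coordinates, evaluated on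
consecutive disjoint blocks of length `m`. -/
theorem ae_shift (hζ : IsIID ζ μ) {Ψ : (ℕ → E) → ℝ} (hΨ : Measurable Ψ) {m : ℕ}
    (hdep : ∀ z z' : ℕ → E, (∀ i < m, z i = z' i) → Ψ z = Ψ z')
    (hint : Integrable (fun ω => Ψ (ζ ω)) μ) :
    ∀ᵐ ω ∂μ, Tendsto (fun n : ℕ => (∑ j ∈ Finset.range n, Ψ (shift (j * m) (ζ ω))) / n) atTop
      (𝓝 (∫ ω, Ψ (ζ ω) ∂μ)) := by
  have hprob : IsProbabilityMeasure μ := hζ.indep.isProbabilityMeasure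
  obtain ⟨ω₀⟩ : Nonempty Ω := μ.nonempty_of_neZero
  have h := strong_law_ae_real (μ := μ) (fun j ω => Ψ (shift (j * m) (ζ ω)))
    (by simpa using hint) ?_ ?_
  · simpa using h
  · intro i j hij
    have hS : Disjoint (Finset.Ico (i * m) (i * m + m)) (Finset.Ico (j * m) (j * m + m)) := by
      rw [Finset.disjoint_left]
      intro a ha hb
      rw [Finset.mem_Ico] at ha hb
      rcases lt_or_gt_of_ne hij with h | h
      · have : (i + 1) * m ≤ j * m := Nat.mul_le_mul_right m h
        rw [add_mul] at this; omega
      · have : (j + 1) * m ≤ i * m := Nat.mul_le_mul_right m h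
        rw [add_mul] at this; omega
    have hmeas : ∀ i, Measurable fun ω => ζ ω i := fun i =>
      (measurable_pi_apply i).comp hζ.measurable
    have hind := hζ.indep.indepFun_finset _ _ hS hmeas
    -- the functional as a function of the coordinates in the block only; the default value
    -- outside of the block is irrelevant by `hdep`
    let Φ : (j : ℕ) → (Finset.Ico (j * m) (j * m + m) → E) → ℝ := fun j y =>
      Ψ fun i => if h : j * m + i ∈ Finset.Ico (j * m) (j * m + m) then y ⟨_, h⟩ else ζ ω₀ 0
    have hΦ : ∀ j, Measurable (Φ j) := fun j => by
      refine hΨ.comp (measurable_pi_lambda _ fun i => ?_)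
      by_cases h : j * m + i ∈ Finset.Ico (j * m) (j * m + m)
      · simp only [h, dite_true]
        exact measurable_pi_apply _
      · simp only [h, dite_false]
        exact measurable_const
    have hΦeq : ∀ j, (fun ω => Ψ (shift (j * m) (ζ ω)))
        = Φ j ∘ fun ω (i : Finset.Ico (j * m) (j * m + m)) => ζ ω i := fun j => by
      funext ω
      refine hdep _ _ fun i hi => ?_
      have h : j * m + i ∈ Finset.Ico (j * m) (j * m + m) := Finset.mem_Ico.2 (by omega)
      simp only [h, dite_true, shift]
    simp only [Function.onFun]
    rw [hΦeq i, hΦeq j]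
    exact hind.comp (hΦ i) (hΦ j)
  · intro i
    simpa using hζ.identDistrib_comp_shift hΨ (i * m)

/-- Almost sure uniform upper bound for a subadditive functional of an i.i.d. sequence, from the
mean of its truncation over one block. -/
theorem ae_eventually_le (hζ : IsIID ζ μ) {Ψ : ℕ → (ℕ → E) → ℝ} (hΨ : ∀ n, Measurable (Ψ n))
    (hdep : ∀ n, ∀ z z' : ℕ → E, (∀ i < n, z i = z' i) → Ψ n z = Ψ n z')
    (hsub : ∀ᵐ ω ∂μ, ∀ k a b, Ψ (a + b) (shift k (ζ ω)) ≤
      Ψ a (shift k (ζ ω)) + Ψ b (shift (k + a) (ζ ω)))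
    (h0 : ∀ z, Ψ 0 z ≤ 0) (hint₁ : Integrable (fun ω => max (Ψ 1 (ζ ω)) 0) μ) {m : ℕ} (hm : 0 < m)
    {C : ℝ} (hint : Integrable (fun ω => max (Ψ m (ζ ω)) (-C)) μ) {L : ℝ}
    (hL : ∫ ω, max (Ψ m (ζ ω)) (-C) ∂μ ≤ m * L) :
    ∀ᵐ ω ∂μ, ∀ ε > 0, ∀ᶠ n : ℕ in atTop, ∀ k ≤ n,
      Ψ (n - k) (shift k (ζ ω)) ≤ L * ((n : ℝ) - k) + ε * n := by
  have hW := hζ.ae_shift (Ψ := fun z => max (Ψ 1 z) 0) ((hΨ 1).max measurable_const) (m := 1)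
    (fun z z' h => by simp only [hdep 1 z z' h]) hint₁
  have hX := hζ.ae_shift (Ψ := fun z => max (Ψ m z) (-C)) ((hΨ m).max measurable_const) (m := m)
    (fun z z' h => by simp only [hdep m z z' h]) hint
  filter_upwards [hsub, hW, hX] with ω hsub hW hX ε hε
  have key := eventually_le_of_subadditive (H := fun k l => Ψ (l - k) (shift k (ζ ω)))
    (W := fun i => max (Ψ 1 (shift i (ζ ω))) 0) hm ?_ ?_ ?_ ?_ ?_ (by simpa using hW) hX hL hε
  · filter_upwards [key] with n hn k hk
    exact hn k n hk le_rfl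
  · intro k j l hkj hjl
    have h := hsub k (j - k) (l - j)
    rwa [show j - k + (l - j) = l - k by omega, show k + (j - k) = j by omega] at h
  · intro k
    simpa using h0 _
  · intro i
    exact le_max_right _ _
  · intro i
    simp
  · intro j
    rw [show (j + 1) * m - j * m = m by rw [add_mul]; omega]
    exact le_max_left _ _

end IsIID

end iid

section extExpectation

variable {Ω : Type*} [MeasurableSpace Ω] {μ : Measure Ω} {f g : Ω → ℝ}

theorem extExpectation_congr (h : f =ᵐ[μ] g) : extExpectation μ f = extExpectation μ g := by
  have h1 : ∫⁻ ω, ENNReal.ofReal (f ω) ∂μ = ∫⁻ ω, ENNReal.ofReal (g ω) ∂μ :=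
    lintegral_congr_ae (h.mono fun ω hω => by simp only [hω])
  have h2 : ∫⁻ ω, ENNReal.ofReal (-f ω) ∂μ = ∫⁻ ω, ENNReal.ofReal (-g ω) ∂μ :=
    lintegral_congr_ae (h.mono fun ω hω => by simp only [hω])
  rw [extExpectation, extExpectation, h1, h2]

theorem integrable_iff_lintegral_ofReal (hf : AEStronglyMeasurable f μ) :
    Integrable f μ ↔ ∫⁻ ω, ENNReal.ofReal (f ω) ∂μ ≠ ⊤ ∧ ∫⁻ ω, ENNReal.ofReal (-f ω) ∂μ ≠ ⊤ := by
  refine ⟨fun h => ⟨h.lintegral_lt_top.ne, h.neg.lintegral_lt_top.ne⟩, fun h => ⟨hf, ?_⟩⟩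
  rw [hasFiniteIntegral_iff_norm]
  calc ∫⁻ ω, ENNReal.ofReal ‖f ω‖ ∂μ
      ≤ ∫⁻ ω, (ENNReal.ofReal (f ω) + ENNReal.ofReal (-f ω)) ∂μ := by
        refine lintegral_mono fun ω => ?_
        rw [Real.norm_eq_abs]
        rcases abs_cases (f ω) with ⟨h, -⟩ | ⟨h, -⟩ <;> rw [h]
        · exact le_self_add
        · exact le_add_self
    _ = _ := lintegral_add_left' hf.aemeasurable.ennreal_ofReal _
    _ < ⊤ := ENNReal.add_lt_top.2 ⟨h.1.lt_top, h.2.lt_top⟩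

theorem extExpectation_eq_integral (hf : Integrable f μ) :
    extExpectation μ f = ((∫ ω, f ω ∂μ : ℝ) : EReal) := by
  have h := (integrable_iff_lintegral_ofReal hf.1).1 hf
  rw [extExpectation, integral_eq_lintegral_pos_part_sub_lintegral_neg_part hf, EReal.coe_sub,
    EReal.coe_ennreal_toReal h.1, EReal.coe_ennreal_toReal h.2]

theorem extExpectation_eq_bot (hf : AEStronglyMeasurable f μ)
    (hpos : ∫⁻ ω, ENNReal.ofReal (f ω) ∂μ ≠ ⊤) (h : ¬ Integrable f μ) :
    extExpectation μ f = ⊥ := by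
  have h2 : ∫⁻ ω, ENNReal.ofReal (-f ω) ∂μ = ⊤ := by
    by_contra h2
    exact h ((integrable_iff_lintegral_ofReal hf).2 ⟨hpos, h2⟩)
  rw [extExpectation, h2, EReal.coe_ennreal_top, EReal.sub_top]

/-- A strict upper bound on an expectation in `[-∞, ∞)` persists under truncation far below. -/
theorem exists_integral_max_lt [IsFiniteMeasure μ] (hf : Measurable f)
    (hpos : ∫⁻ ω, ENNReal.ofReal (f ω) ∂μ ≠ ⊤) {a : ℝ} (ha : extExpectation μ f < a) :
    ∃ C : ℝ, Integrable (fun ω => max (f ω) (-C)) μ ∧ ∫ ω, max (f ω) (-C) ∂μ < a := by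
  have hint : ∀ C : ℕ, Integrable (fun ω => max (f ω) (-C)) μ := fun C => by
    refine (integrable_iff_lintegral_ofReal (hf.max measurable_const).aestronglyMeasurable).2
      ⟨?_, ?_⟩
    · refine ne_top_of_le_ne_top hpos (lintegral_mono fun ω => ?_)
      rw [ENNReal.ofReal_max, ENNReal.ofReal_of_nonpos (p := -(C : ℝ)) (by simp)]
      simp
    · refine ne_top_of_le_ne_top (b := ∫⁻ _, ENNReal.ofReal C ∂μ) ?_ (lintegral_mono fun ω => ?_)
      · rw [lintegral_const]
        exact ENNReal.mul_ne_top ENNReal.ofReal_ne_top (measure_ne_top _ _)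
      · exact ENNReal.ofReal_le_ofReal (neg_le.1 (le_max_right _ _))
  have hlim : Tendsto (fun C : ℕ => ∫⁻ ω, ENNReal.ofReal (-max (f ω) (-C)) ∂μ) atTop
      (𝓝 (∫⁻ ω, ENNReal.ofReal (-f ω) ∂μ)) := by
    refine lintegral_tendsto_of_tendsto_of_monotone (fun C => ?_) ?_ ?_
    · exact ((hf.max measurable_const).neg.ennreal_ofReal).aemeasurable
    · refine ae_of_all _ fun ω C D hCD => ENNReal.ofReal_le_ofReal (neg_le_neg ?_)
      have : (C : ℝ) ≤ D := by exact_mod_cast hCD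
      exact max_le_max le_rfl (by linarith)
    · refine ae_of_all _ fun ω => tendsto_const_nhds.congr' ?_
      filter_upwards [eventually_ge_atTop ⌈-f ω⌉₊] with C hC
      have := (Nat.le_ceil (-f ω)).trans (Nat.cast_le.2 hC)
      rw [max_eq_left (by linarith)]
  have hlim2 : Tendsto (fun C : ℕ => extExpectation μ fun ω => max (f ω) (-C)) atTop
      (𝓝 (extExpectation μ f)) := by
    have hp : ∀ C : ℕ, ∫⁻ ω, ENNReal.ofReal (max (f ω) (-C)) ∂μ = ∫⁻ ω, ENNReal.ofReal (f ω) ∂μ :=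
      fun C => lintegral_congr fun ω => by
        rw [ENNReal.ofReal_max, ENNReal.ofReal_of_nonpos (p := -(C : ℝ)) (by simp)]
        simp
    simp only [extExpectation, hp, sub_eq_add_neg]
    have h1 : Tendsto
        (fun C : ℕ => -((∫⁻ ω, ENNReal.ofReal (-max (f ω) (-C)) ∂μ : ENNReal) : EReal))
        atTop (𝓝 (-((∫⁻ ω, ENNReal.ofReal (-f ω) ∂μ : ENNReal) : EReal))) :=
      (continuous_neg.tendsto _).comp ((continuous_coe_ennreal_ereal.tendsto _).comp hlim)
    have hc := EReal.continuousAt_add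
      (p := (((∫⁻ ω, ENNReal.ofReal (f ω) ∂μ : ENNReal) : EReal),
        -((∫⁻ ω, ENNReal.ofReal (-f ω) ∂μ : ENNReal) : EReal)))
      (Or.inl (by simpa using hpos)) (Or.inl (by simp))
    exact hc.tendsto.comp (tendsto_const_nhds.prodMk_nhds h1)
  obtain ⟨C, hC⟩ := (hlim2.eventually (gt_mem_nhds ha)).exists
  refine ⟨C, hint C, ?_⟩
  rwa [extExpectation_eq_integral (hint C), EReal.coe_lt_coe_iff] at hC

end extExpectation

/-! ### The growth exponent and almost sure upper bounds -/

theorem log_growth_one_nonneg (z : ℕ → ℝ × ℝ) : 0 ≤ Real.log (growth z 1) :=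
  Real.log_nonneg (by rw [growth_one]; exact le_max_left _ _)

theorem log_growth_add_le {z : ℕ → ℝ × ℝ} (hz : PosSeq z) (a b : ℕ) :
    Real.log (growth z (a + b)) ≤ Real.log (growth z a) + Real.log (growth (shift a z) b) := by
  rw [← Real.log_mul (growth_pos hz a).ne' (growth_pos (hz.shift a) b).ne']
  exact Real.log_le_log (growth_pos hz _) (growth_add_le hz a b)

theorem log_growth_le_sum {z : ℕ → ℝ × ℝ} (hz : PosSeq z) (n : ℕ) :
    Real.log (growth z n) ≤ ∑ i ∈ Finset.range n, Real.log (growth (shift i z) 1) := by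
  induction n with
  | zero => simp [growth_zero]
  | succ n ih =>
    rw [Finset.sum_range_succ]
    linarith [log_growth_add_le hz n 1]

theorem measurable_log_growth (n : ℕ) : Measurable fun z => Real.log (growth z n) :=
  (measurable_growth n).log

section

variable {Ω : Type*} [MeasurableSpace Ω] {μ : Measure Ω} {ζ : Ω → ℕ → ℝ × ℝ}

theorem IsIID.integrable_shift (hζ : IsIID ζ μ) {Ψ : (ℕ → ℝ × ℝ) → ℝ} (hΨ : Measurable Ψ)
    (h : Integrable (fun ω => Ψ (ζ ω)) μ) (k : ℕ) : Integrable (fun ω => Ψ (shift k (ζ ω))) μ :=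
  (hζ.identDistrib_comp_shift hΨ k).integrable_iff.2 h

/-- The exponential growth rate of the recursion; the product `A n ⋯ A 2` has `n - 1` factors. -/
noncomputable def growthExponent (ζ : Ω → ℕ → ℝ × ℝ) (μ : Measure Ω) : EReal :=
  limsup (fun n : ℕ => ((1 / (n : ℝ) : ℝ) : EReal)
    * extExpectation μ fun ω => Real.log (growth (ζ ω) (n - 1))) atTop

theorem upperLyapunovExponent_infoMatrix {e : Ω → ℕ → ℕ → ℝ}
    (he : ∀ᵐ ω ∂μ, PosSeq (inLinks (e ω))) :
    upperLyapunovExponent μ (fun ω => infoMatrix (e ω))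
      = growthExponent (fun ω => inLinks (e ω)) μ := by
  refine limsup_congr ?_
  filter_upwards [eventually_ge_atTop 1] with n hn
  obtain ⟨m, rfl⟩ := Nat.exists_eq_add_of_le' hn
  congr 1
  refine extExpectation_congr ?_
  filter_upwards [he] with ω hω
  rw [norm_orderedProd_infoMatrix _ hω, Nat.add_sub_cancel]

theorem exists_extExpectation_lt {L : ℝ} (hL : growthExponent ζ μ < L) :
    ∃ m : ℕ, 0 < m ∧
      extExpectation μ (fun ω => Real.log (growth (ζ ω) m)) < ((m * L : ℝ) : EReal) := by
  obtain ⟨L', h1, h2⟩ := EReal.lt_iff_exists_real_btwn.1 hL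
  rw [EReal.coe_lt_coe_iff] at h2
  have h3 := (tendsto_add_atTop_nat 1).eventually (eventually_lt_of_limsup_lt h1)
  have h4 : ∀ᶠ m : ℕ in atTop, L' ≤ (L - L') * m :=
    (tendsto_natCast_atTop_atTop.const_mul_atTop (sub_pos.2 h2)).eventually_ge_atTop _
  obtain ⟨m, hm3, hm4, hm⟩ := (h3.and (h4.and (eventually_gt_atTop 0))).exists
  refine ⟨m, hm, ?_⟩
  rw [Nat.add_sub_cancel] at hm3
  have hpos : (0 : ℝ) < 1 / ((m + 1 : ℕ) : ℝ) := by positivity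
  generalize extExpectation μ (fun ω => Real.log (growth (ζ ω) m)) = x at hm3 ⊢
  induction x with
  | bot => exact EReal.bot_lt_coe _
  | top =>
    rw [EReal.coe_mul_top_of_pos hpos] at hm3
    exact absurd hm3 (not_lt.2 le_top)
  | coe x =>
    rw [← EReal.coe_mul, EReal.coe_lt_coe_iff, one_div, inv_mul_lt_iff₀ (by positivity)] at hm3
    push_cast at hm3
    rw [EReal.coe_lt_coe_iff]
    linarith

theorem integrable_sum_log_growth_one (hζ : IsIID ζ μ)
    (hint : Integrable (fun ω => Real.log (growth (ζ ω) 1)) μ) (n : ℕ) :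
    Integrable (fun ω => ∑ i ∈ Finset.range n, Real.log (growth (shift i (ζ ω)) 1)) μ :=
  integrable_finsetSum _ fun i _ => hζ.integrable_shift (measurable_log_growth 1) hint i

theorem integral_sum_log_growth_one (hζ : IsIID ζ μ)
    (hint : Integrable (fun ω => Real.log (growth (ζ ω) 1)) μ) (n : ℕ) :
    ∫ ω, ∑ i ∈ Finset.range n, Real.log (growth (shift i (ζ ω)) 1) ∂μ
      = n * ∫ ω, Real.log (growth (ζ ω) 1) ∂μ := by
  rw [integral_finsetSum _ fun i _ => hζ.integrable_shift (measurable_log_growth 1) hint i]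
  rw [Finset.sum_congr rfl fun i _ =>
    (hζ.identDistrib_comp_shift (measurable_log_growth 1) i).integral_eq]
  simp

variable (hζ : IsIID ζ μ) (hpos : ∀ᵐ ω ∂μ, PosSeq (ζ ω))
  (hint : Integrable (fun ω => Real.log (growth (ζ ω) 1)) μ)
include hζ hpos hint

theorem lintegral_log_growth_ne_top (n : ℕ) :
    ∫⁻ ω, ENNReal.ofReal (Real.log (growth (ζ ω) n)) ∂μ ≠ ⊤ := by
  refine ne_top_of_le_ne_top (integrable_sum_log_growth_one hζ hint n).lintegral_lt_top.ne
    (lintegral_mono_ae ?_)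
  filter_upwards [hpos] with ω hω
  exact ENNReal.ofReal_le_ofReal (log_growth_le_sum hω n)

theorem integral_log_growth_le {n : ℕ} (hn : Integrable (fun ω => Real.log (growth (ζ ω) n)) μ) :
    ∫ ω, Real.log (growth (ζ ω) n) ∂μ ≤ n * ∫ ω, Real.log (growth (ζ ω) 1) ∂μ := by
  rw [← integral_sum_log_growth_one hζ hint]
  refine integral_mono_ae hn (integrable_sum_log_growth_one hζ hint n) ?_
  filter_upwards [hpos] with ω hω
  exact log_growth_le_sum hω n

theorem extExpectation_log_growth_of_not_integrable {n : ℕ}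
    (hn : ¬ Integrable (fun ω => Real.log (growth (ζ ω) n)) μ) :
    extExpectation μ (fun ω => Real.log (growth (ζ ω) n)) = ⊥ :=
  extExpectation_eq_bot ((measurable_log_growth n).comp hζ.measurable).aestronglyMeasurable
    (lintegral_log_growth_ne_top hζ hpos hint n) hn

theorem growthExponent_lt_top : growthExponent ζ μ < ⊤ := by
  set w := ∫ ω, Real.log (growth (ζ ω) 1) ∂μ with hw
  have hw0 : 0 ≤ w := integral_nonneg fun ω => log_growth_one_nonneg _
  refine lt_of_le_of_lt (limsup_le_of_le (a := (w : EReal)) (by isBoundedDefault) ?_)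
    (EReal.coe_lt_top w)
  filter_upwards [eventually_ge_atTop 1] with n hn
  have hn0 : (0 : ℝ) < n := by exact_mod_cast hn
  by_cases h : Integrable (fun ω => Real.log (growth (ζ ω) (n - 1))) μ
  · rw [extExpectation_eq_integral h, ← EReal.coe_mul, EReal.coe_le_coe_iff]
    have h1 := integral_log_growth_le hζ hpos hint h
    have h2 : ((n - 1 : ℕ) : ℝ) * w ≤ n * w := by
      gcongr
      omega
    rw [one_div, inv_mul_le_iff₀ hn0]
    exact h1.trans h2
  · rw [extExpectation_log_growth_of_not_integrable hζ hpos hint h,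
      EReal.coe_mul_bot_of_pos (by positivity)]
    exact bot_le

/-- Almost sure upper bound for the growth from node `k` to node `n`, uniform in `k`. -/
theorem ae_eventually_log_growth_le {L : ℝ} (hL : growthExponent ζ μ < L) :
    ∀ᵐ ω ∂μ, ∀ ε > 0, ∀ᶠ n : ℕ in atTop, ∀ k ≤ n,
      Real.log (growth (shift k (ζ ω)) (n - k)) ≤ L * ((n : ℝ) - k) + ε * n := by
  have hprob : IsProbabilityMeasure μ := hζ.indep.isProbabilityMeasure
  obtain ⟨m, hm, hmL⟩ := exists_extExpectation_lt hL
  obtain ⟨C, hC, hCL⟩ := exists_integral_max_lt ((measurable_log_growth m).comp hζ.measurable)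
    (lintegral_log_growth_ne_top hζ hpos hint m) hmL
  refine hζ.ae_eventually_le (Ψ := fun n z => Real.log (growth z n)) measurable_log_growth
    (fun n z z' h => by simp only [growth_congr h]) ?_ (fun z => by simp [growth_zero]) ?_ hm hC
    hCL.le
  · filter_upwards [hpos] with ω hω k a b
    have := log_growth_add_le (hω.shift k) a b
    rwa [shift_shift] at this
  · simpa [max_eq_left (log_growth_one_nonneg _)] using hint

/-- If the logarithmic growth over `m` steps has mean `-∞`, so has that over any larger number of
steps. -/
theorem integrable_log_growth (hbot : growthExponent ζ μ ≠ ⊥) (m : ℕ) :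
    Integrable (fun ω => Real.log (growth (ζ ω) m)) μ := by
  by_contra hm
  apply hbot
  rw [eq_bot_iff]
  refine limsup_le_of_le (by isBoundedDefault) ?_
  filter_upwards [eventually_ge_atTop (m + 1)] with n hn
  obtain ⟨k, rfl⟩ := Nat.exists_eq_add_of_le hn
  have hn : ¬ Integrable (fun ω => Real.log (growth (ζ ω) (m + k))) μ := fun hn => by
    apply hm
    have hk := hζ.integrable_shift (Ψ := fun z => ∑ i ∈ Finset.range k,
      Real.log (growth (shift i z) 1)) (Finset.measurable_sum _ fun i _ =>
        (measurable_log_growth 1).comp (measurable_shift i))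
      (integrable_sum_log_growth_one hζ hint k) m
    refine integrable_of_le_of_le
      ((measurable_log_growth m).comp hζ.measurable).aestronglyMeasurable ?_ ?_
      (hn.sub hk) (integrable_sum_log_growth_one hζ hint m)
    · filter_upwards [hpos] with ω hω
      have h1 := log_growth_add_le hω m k
      have h2 := log_growth_le_sum (hω.shift m) k
      simp only [Pi.sub_apply]
      linarith
    · filter_upwards [hpos] with ω hω
      exact log_growth_le_sum hω m
  rw [show m + 1 + k - 1 = m + k by omega,
    extExpectation_log_growth_of_not_integrable hζ hpos hint hn,
    EReal.coe_mul_bot_of_pos (by positivity)]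

/-- Fekete's lemma: the exponent is a lower bound for the mean growth per step. -/
theorem growthExponent_mul_le_integral (hbot : growthExponent ζ μ ≠ ⊥) (m : ℕ) :
    m * (growthExponent ζ μ).toReal ≤ ∫ ω, Real.log (growth (ζ ω) m) ∂μ := by
  have hI := integrable_log_growth hζ hpos hint hbot
  have htop := (growthExponent_lt_top hζ hpos hint).ne
  have hsub : Subadditive fun n => ∫ ω, Real.log (growth (ζ ω) n) ∂μ := fun a b => by
    have hb := hζ.integrable_shift (measurable_log_growth b) (hI b) a
    simp only
    rw [← (hζ.identDistrib_comp_shift (measurable_log_growth b) a).integral_eq,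
      ← integral_add (hI a) hb]
    refine integral_mono_ae (hI _) ((hI a).add hb) ?_
    filter_upwards [hpos] with ω hω
    exact log_growth_add_le hω a b
  rcases Nat.eq_zero_or_pos m with rfl | hm
  · simp [growth_zero]
  have hm0 : (0 : ℝ) < m := by exact_mod_cast hm
  by_contra! hlt
  obtain ⟨L, h1, h2⟩ := exists_between ((div_lt_iff₀' hm0).2 hlt)
  obtain ⟨L', h3, h4⟩ := exists_between h2
  have h5 := hsub.eventually_div_lt_of_div_lt hm.ne' h1
  have h6 : ∀ᶠ n : ℕ in atTop, -L' ≤ (L' - L) * n :=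
    (tendsto_natCast_atTop_atTop.const_mul_atTop (sub_pos.2 h3)).eventually_ge_atTop _
  have h7 : growthExponent ζ μ ≤ (L' : EReal) := by
    refine limsup_le_of_le (by isBoundedDefault) ?_
    filter_upwards [(tendsto_sub_atTop_nat 1).eventually (h5.and h6), eventually_ge_atTop 2]
      with n hn hn2
    obtain ⟨k, rfl⟩ := Nat.exists_eq_add_of_le' hn2
    rw [show k + 2 - 1 = k + 1 by omega] at hn ⊢
    rw [extExpectation_eq_integral (hI _), ← EReal.coe_mul, EReal.coe_le_coe_iff, one_div,
      inv_mul_le_iff₀ (by positivity)]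
    have h := (div_lt_iff₀' (by positivity)).1 hn.1
    have h' := hn.2
    push_cast at h h' ⊢
    linarith
  rw [← EReal.coe_toReal htop hbot, EReal.coe_le_coe_iff] at h7
  linarith

end

/-! ### Lower bounds for the growth -/

theorem log_pathWeight_add_ge {z : ℕ → ℝ × ℝ} (hz : PosSeq z) (a b : ℕ) :
    Real.log (pathWeight z a) + Real.log (pathWeight (shift a z) b) ≤
      Real.log (pathWeight z (a + b)) := by
  have h1 := pathWeight_pos hz a
  have h2 := pathWeight_pos (hz.shift a) b
  rw [← Real.log_mul h1.ne' h2.ne']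
  exact Real.log_le_log (mul_pos h1 h2) (mul_pathWeight_le_add hz a b)

theorem sum_log_le_log_pathWeight {z : ℕ → ℝ × ℝ} (hz : PosSeq z) (n : ℕ) :
    ∑ i ∈ Finset.range n, Real.log (shift i z 0).2 ≤ Real.log (pathWeight z n) := by
  induction n with
  | zero => simp [pathWeight_zero]
  | succ n ih =>
    rw [Finset.sum_range_succ]
    have := log_pathWeight_add_ge hz n 1
    rw [pathWeight_one] at this
    linarith

theorem measurable_log_pathWeight (n : ℕ) : Measurable fun z => Real.log (pathWeight z n) :=
  (measurable_pathWeight n).log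

theorem log_one_add_inv_nonneg {x : ℝ} (hx : 0 < x) : 0 ≤ Real.log (1 + x⁻¹) :=
  Real.log_nonneg (by have := inv_pos.2 hx; linarith)

theorem log_one_add_inv_le {x : ℝ} (hx : 0 < x) :
    Real.log (1 + x⁻¹) ≤ Real.log 2 + |Real.log x| := by
  have hx' := inv_pos.2 hx
  have hmax : 0 < max 1 x⁻¹ := lt_max_of_lt_left one_pos
  calc Real.log (1 + x⁻¹) ≤ Real.log (2 * max 1 x⁻¹) :=
        Real.log_le_log (by linarith) (by linarith [le_max_left 1 x⁻¹, le_max_right 1 x⁻¹])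
    _ = Real.log 2 + Real.log (max 1 x⁻¹) := Real.log_mul two_ne_zero hmax.ne'
    _ ≤ _ := by
      gcongr
      rcases max_choice 1 x⁻¹ with h | h <;> rw [h]
      · simp
      · rw [Real.log_inv]; exact neg_le_abs _

section

variable {Ω : Type*} [MeasurableSpace Ω] {μ : Measure Ω} {ζ : Ω → ℕ → ℝ × ℝ}

theorem tendsto_measure_lt_of_ae [IsFiniteMeasure μ] {f : ℕ → Ω → ℝ} {c : ℝ}
    (hf : ∀ n, Measurable (f n)) (h : ∀ᵐ ω ∂μ, Tendsto (fun n => f n ω) atTop (𝓝 c)) {b : ℝ}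
    (hb : b < c) : Tendsto (fun n => μ {ω | f n ω < b}) atTop (𝓝 0) := by
  have h1 := tendstoInMeasure_of_tendsto_ae (fun n => (hf n).aestronglyMeasurable) h
  rw [tendstoInMeasure_iff_dist] at h1
  refine tendsto_of_tendsto_of_tendsto_of_le_of_le tendsto_const_nhds (h1 (c - b) (sub_pos.2 hb))
    (fun _ => zero_le) fun n => measure_mono fun ω (hω : f n ω < b) => ?_
  simp only [Set.mem_ofPred_eq, Real.dist_eq]
  rw [abs_sub_comm]
  exact le_trans (by linarith) (le_abs_self _)

theorem tendsto_measure_lt_neg_mul [IsFiniteMeasure μ] {V : Ω → ℝ} (hV : Measurable V) {ε : ℝ}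
    (hε : 0 < ε) : Tendsto (fun n : ℕ => μ {ω | V ω < -(n * ε)}) atTop (𝓝 0) := by
  have h := tendsto_measure_lt_of_ae (μ := μ) (f := fun (n : ℕ) ω => V ω / n) (c := 0) (b := -ε)
    (fun n => hV.div_const _) (ae_of_all _ fun ω => tendsto_const_div_atTop_nhds_zero_nat _)
    (by linarith)
  refine h.congr' ?_
  filter_upwards [eventually_gt_atTop 0] with n hn
  have hn : (0 : ℝ) < n := by exact_mod_cast hn
  congr 1
  ext ω
  simp only [Set.mem_ofPred_eq]
  rw [div_lt_iff₀ hn, neg_mul, mul_comm]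

variable (hζ : IsIID ζ μ) (hpos : ∀ᵐ ω ∂μ, PosSeq (ζ ω))
  (hint : Integrable (fun ω => Real.log (growth (ζ ω) 1)) μ)
include hζ hpos hint

/-- Lower bound in probability for the growth. The means are at least `n * λ` and the almost sure
upper bound is asymptotically equal to them, so there is no room for a deficit of positive
probability. -/
theorem tendsto_measure_log_growth_lt (hbot : growthExponent ζ μ ≠ ⊥) {ε : ℝ} (hε : 0 < ε) :
    Tendsto (fun n : ℕ => μ {ω | Real.log (growth (ζ ω) n) < n * ((growthExponent ζ μ).toReal - ε)})
      atTop (𝓝 0) := by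
  have hprob : IsProbabilityMeasure μ := hζ.indep.isProbabilityMeasure
  set l := (growthExponent ζ μ).toReal with hl
  set w := ∫ ω, Real.log (growth (ζ ω) 1) ∂μ with hw
  set u := w - l with hu
  have hltop := (growthExponent_lt_top hζ hpos hint).ne
  have hI := integrable_log_growth hζ hpos hint hbot
  have hu0 : 0 ≤ u := by
    have := growthExponent_mul_le_integral hζ hpos hint hbot 1
    rw [Nat.cast_one, one_mul] at this
    exact sub_nonneg.2 this
  set S : ℕ → Ω → ℝ := fun n ω => ∑ i ∈ Finset.range n, Real.log (growth (shift i (ζ ω)) 1) with hS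
  have hSm : ∀ n, Measurable (S n) := fun n => Finset.measurable_sum _ fun i _ =>
    (measurable_log_growth 1).comp ((measurable_shift i).comp hζ.measurable)
  have hFm : ∀ n, Measurable fun ω => Real.log (growth (ζ ω) n) := fun n =>
    (measurable_log_growth n).comp hζ.measurable
  have hSlim : ∀ᵐ ω ∂μ, Tendsto (fun n : ℕ => S n ω / n) atTop (𝓝 w) := by
    have := hζ.ae_shift (measurable_log_growth 1) (m := 1)
      (fun z z' h => by rw [growth_congr h]) hint
    simpa using this
  have hSI := integrable_sum_log_growth_one hζ hint
  -- the nonnegative deficit of the logarithmic growth below the trivial bound `S n`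
  set V : ℕ → Ω → ℝ := fun n ω => (S n ω - Real.log (growth (ζ ω) n)) / n with hV
  have hVm : ∀ n, Measurable (V n) := fun n => ((hSm n).sub (hFm n)).div_const _
  have hVI : ∀ n, Integrable (V n) μ := fun n => ((hSI n).sub (hI n)).div_const _
  have hV0 : ∀ᵐ ω ∂μ, ∀ n, 0 ≤ V n ω := by
    filter_upwards [hpos] with ω hω n
    exact div_nonneg (sub_nonneg.2 (log_growth_le_sum hω n)) n.cast_nonneg
  have hVint : ∀ n : ℕ, 0 < n → ∫ ω, V n ω ∂μ ≤ u := fun n hn => by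
    have hn : (0 : ℝ) < n := by exact_mod_cast hn
    have h1 := growthExponent_mul_le_integral hζ hpos hint hbot n
    have h2 := integral_sum_log_growth_one hζ hint n
    rw [integral_div, integral_sub (hSI n) (hI n), h2, div_le_iff₀ hn, hu]
    linarith
  have hupper : ∀ᵐ ω ∂μ, ∀ j : ℕ, ∀ ε > 0, ∀ᶠ n : ℕ in atTop,
      Real.log (growth (ζ ω) n) ≤ (l + 1 / ((j : ℝ) + 1)) * n + ε * n := by
    rw [ae_all_iff]
    intro j
    have hlt : growthExponent ζ μ < ((l + 1 / ((j : ℝ) + 1) : ℝ) : EReal) := by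
      rw [← EReal.coe_toReal hltop hbot, EReal.coe_lt_coe_iff]
      have : (0 : ℝ) < 1 / ((j : ℝ) + 1) := by positivity
      linarith
    filter_upwards [ae_eventually_log_growth_le hζ hpos hint hlt] with ω hω ε hε
    filter_upwards [hω ε hε] with n hn
    simpa using hn 0 (Nat.zero_le n)
  -- the almost sure upper bound for the growth is a lower bound for the deficit
  have hG : ∀ᵐ ω ∂μ, Tendsto (fun n => min (V n ω) u) atTop (𝓝 u) := by
    filter_upwards [hSlim, hupper] with ω hω hωu
    rw [Metric.tendsto_nhds]
    intro η hη
    obtain ⟨j, hj⟩ := exists_nat_one_div_lt (by positivity : (0 : ℝ) < η / 4)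
    filter_upwards [hωu j (η / 4) (by positivity), hω.eventually (lt_mem_nhds
      (show w - η / 4 < w by linarith)), eventually_gt_atTop 0] with n h1 h2 hn
    have hn : (0 : ℝ) < n := by exact_mod_cast hn
    have h3 : u - η < V n ω := by
      have h4 : V n ω = S n ω / n - Real.log (growth (ζ ω) n) / n := sub_div _ _ _
      have h5 : Real.log (growth (ζ ω) n) / n ≤ l + 1 / ((j : ℝ) + 1) + η / 4 := by
        rw [div_le_iff₀ hn]; linarith
      rw [h4]; linarith
    rw [Real.dist_eq, abs_lt]
    constructor
    · rcases min_choice (V n ω) u with h | h <;> rw [h] <;> linarith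
    · have := min_le_right (V n ω) u
      linarith
  have hGint : Tendsto (fun n => ∫ ω, min (V n ω) u ∂μ) atTop (𝓝 u) := by
    have h := tendsto_integral_of_dominated_convergence (μ := μ)
      (F := fun n ω => min (V n ω) u) (f := fun _ => u) (fun _ => u)
      (fun n => ((hVm n).min measurable_const).aestronglyMeasurable)
      (integrable_const _) (fun n => ?_) hG
    · simpa using h
    · filter_upwards [hV0] with ω hω
      rw [Real.norm_eq_abs, abs_of_nonneg (le_min (hω n) hu0)]
      exact min_le_right _ _
  have hGI : ∀ n, Integrable (fun ω => min (V n ω) u) μ := fun n =>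
    (hVI n).inf (integrable_const u)
  -- the mean of the excess of `V n` over `u` tends to zero
  have hmarkov : Tendsto (fun n => μ {ω | ε / 2 ≤ V n ω - min (V n ω) u}) atTop (𝓝 0) := by
    have hb : Tendsto (fun n => ENNReal.ofReal ((u - ∫ ω, min (V n ω) u ∂μ) / (ε / 2))) atTop
        (𝓝 0) := by
      have h : Tendsto (fun n => (u - ∫ ω, min (V n ω) u ∂μ) / (ε / 2)) atTop (𝓝 0) := by
        have := (hGint.const_sub u).div_const (ε / 2)
        simpa using this
      simpa using ENNReal.tendsto_ofReal h
    refine tendsto_of_tendsto_of_tendsto_of_le_of_le' tendsto_const_nhds hb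
      (Eventually.of_forall fun _ => zero_le) ?_
    filter_upwards [eventually_gt_atTop 0] with n hn
    have h1 := mul_meas_ge_le_integral_of_nonneg (μ := μ)
      (f := fun ω => V n ω - min (V n ω) u)
      (ae_of_all _ fun ω => sub_nonneg.2 (min_le_left _ _)) ((hVI n).sub (hGI n)) (ε / 2)
    rw [integral_sub (hVI n) (hGI n)] at h1
    rw [← ofReal_measureReal]
    refine ENNReal.ofReal_le_ofReal ?_
    rw [le_div_iff₀ (by positivity)]
    linarith [hVint n hn]
  have hS' := tendsto_measure_lt_of_ae (μ := μ) (f := fun n ω => S n ω / n)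
    (fun n => (hSm n).div_const _) hSlim (show w - ε / 2 < w by linarith)
  have hsum := hmarkov.add hS'
  rw [add_zero] at hsum
  refine tendsto_of_tendsto_of_tendsto_of_le_of_le' tendsto_const_nhds hsum
      (Eventually.of_forall fun _ => zero_le) ?_
  filter_upwards [eventually_gt_atTop 0] with n hn
  have hn : (0 : ℝ) < n := by exact_mod_cast hn
  refine (measure_mono fun ω hω => ?_).trans (measure_union_le _ _)
  by_contra hcon
  simp only [Set.mem_union, Set.mem_ofPred_eq, not_or, not_le, not_lt] at hcon hω
  have h4 : V n ω = S n ω / n - Real.log (growth (ζ ω) n) / n := sub_div _ _ _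
  have h5 : Real.log (growth (ζ ω) n) / n < l - ε := by
    rw [div_lt_iff₀ hn]; linarith
  have h6 := min_le_right (V n ω) u
  linarith [hcon.1, hcon.2]

/-- The bound of `tendsto_measure_log_growth_lt` for a single coordinate of the state. -/
theorem tendsto_measure_log_linRec_lt (hbot : growthExponent ζ μ ≠ ⊥) {ε : ℝ} (hε : 0 < ε) :
    Tendsto (fun n : ℕ => μ {ω | Real.log (linRec (ζ ω) 1 1 n)
      < n * ((growthExponent ζ μ).toReal - ε)}) atTop (𝓝 0) := by
  have hprob : IsProbabilityMeasure μ := hζ.indep.isProbabilityMeasure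
  set l := (growthExponent ζ μ).toReal with hl
  rw [← tendsto_add_atTop_iff_nat 2]
  have h1 := (tendsto_add_atTop_iff_nat 1).2
    (tendsto_measure_log_growth_lt hζ hpos hint hbot (by positivity : 0 < ε / 3))
  have hm : Measurable fun z : ℕ → ℝ × ℝ => -Real.log (1 + (z 0).2⁻¹) := by fun_prop
  have h2 := tendsto_measure_lt_neg_mul (μ := μ) (hm.comp hζ.measurable) (by positivity : 0 < ε / 3)
  have hsum := h1.add h2
  rw [add_zero] at hsum
  have h3 : ∀ᶠ n : ℕ in atTop, l ≤ ε / 3 * n :=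
    (tendsto_natCast_atTop_atTop.const_mul_atTop (by positivity)).eventually_ge_atTop _
  refine tendsto_of_tendsto_of_tendsto_of_le_of_le' tendsto_const_nhds hsum
      (Eventually.of_forall fun _ => zero_le) ?_
  filter_upwards [h3] with n hn
  -- the loss in passing to one coordinate is not small almost surely, but its law is fixed
  have hid := (hζ.identDistrib_comp_shift hm n).measure_mem_eq
    (measurableSet_Iio (a := -(n * (ε / 3))))
  have hid : μ {ω | -Real.log (1 + (shift n (ζ ω) 0).2⁻¹) < -(n * (ε / 3))}
    = μ {ω | -Real.log (1 + (ζ ω 0).2⁻¹) < -(n * (ε / 3))} := hid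
  simp only [Function.comp]
  rw [← hid]
  refine (measure_mono_ae ?_).trans (measure_union_le _ _)
  filter_upwards [hpos] with ω hω hlt
  change Real.log (linRec (ζ ω) 1 1 (n + 2)) < _ at hlt
  change Real.log (growth (ζ ω) (n + 1)) < _ ∨ -Real.log (1 + (ζ ω n).2⁻¹) < _
  by_contra! hcon
  have h4 := growth_le_linRec hω n
  have hq : 0 < 1 + (ζ ω n).2⁻¹ := by
    have := inv_pos.2 (hω n).2; linarith
  have h5 := Real.log_le_log (growth_pos hω _) h4
  rw [Real.log_mul hq.ne' (linRec_pos hω one_pos one_pos _).ne'] at h5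
  have h6 := hcon.1
  have h7 := hcon.2
  push_cast at h6 hlt
  linarith

section integrableLog

variable (hlog : Integrable (fun ω => Real.log (ζ ω 0).2) μ)
include hlog

theorem integrable_log_pathWeight (n : ℕ) :
    Integrable (fun ω => Real.log (pathWeight (ζ ω) n)) μ := by
  have hm : Measurable fun z : ℕ → ℝ × ℝ => Real.log (z 0).2 := by fun_prop
  refine integrable_of_le_of_le
    ((measurable_log_pathWeight n).comp hζ.measurable).aestronglyMeasurable
    (g₁ := fun ω => ∑ i ∈ Finset.range n, Real.log (shift i (ζ ω) 0).2) ?_ ?_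
    (integrable_finsetSum _ fun i _ => hζ.integrable_shift hm hlog i)
    (integrable_sum_log_growth_one hζ hint n)
  · filter_upwards [hpos] with ω hω
    exact sum_log_le_log_pathWeight hω n
  · filter_upwards [hpos] with ω hω
    exact (Real.log_le_log (pathWeight_pos hω n) (pathWeight_le_growth hω n)).trans
      (log_growth_le_sum hω n)

/-- The path of one-step links alone grows at the finite rate `E log η`. -/
theorem growthExponent_ne_bot : growthExponent ζ μ ≠ ⊥ := by
  intro hbot
  have hm : Measurable fun z : ℕ → ℝ × ℝ => Real.log (z 0).2 := by fun_prop
  set k := ∫ ω, Real.log (ζ ω 0).2 ∂μ with hk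
  obtain ⟨m, -, hm2⟩ := exists_extExpectation_lt (ζ := ζ) (μ := μ) (L := k)
    (by rw [hbot]; exact EReal.bot_lt_coe _)
  have hP := integrable_log_pathWeight hζ hpos hint hlog m
  have hF : Integrable (fun ω => Real.log (growth (ζ ω) m)) μ := by
    refine integrable_of_le_of_le
      ((measurable_log_growth m).comp hζ.measurable).aestronglyMeasurable
      ?_ ?_ hP (integrable_sum_log_growth_one hζ hint m)
    · filter_upwards [hpos] with ω hω
      exact Real.log_le_log (pathWeight_pos hω m) (pathWeight_le_growth hω m)
    · filter_upwards [hpos] with ω hω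
      exact log_growth_le_sum hω m
  rw [extExpectation_eq_integral hF, EReal.coe_lt_coe_iff] at hm2
  refine absurd hm2 (not_lt.2 ?_)
  have hsum : ∫ ω, ∑ i ∈ Finset.range m, Real.log (shift i (ζ ω) 0).2 ∂μ = m * k := by
    rw [integral_finsetSum _ fun i _ => hζ.integrable_shift hm hlog i,
      Finset.sum_congr rfl fun i _ => (hζ.identDistrib_comp_shift hm i).integral_eq]
    simp [hk]
  rw [← hsum]
  refine integral_mono_ae (integrable_finsetSum _ fun i _ => hζ.integrable_shift hm hlog i) hF ?_
  filter_upwards [hpos] with ω hω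
  exact (sum_log_le_log_pathWeight hω m).trans
    (Real.log_le_log (pathWeight_pos hω m) (pathWeight_le_growth hω m))

/-- Almost sure lower bound for the recursion when the logarithms of the gains are integrable: the
subadditive bound applied to `-log (pathWeight z n)`. -/
theorem ae_eventually_exp_le_linRec : ∀ᵐ ω ∂μ, ∀ ε > 0, ∀ᶠ n : ℕ in atTop,
    Real.exp (n * ((growthExponent ζ μ).toReal - ε)) ≤ linRec (ζ ω) 1 1 n := by
  have hprob : IsProbabilityMeasure μ := hζ.indep.isProbabilityMeasure
  have hbot := growthExponent_ne_bot hζ hpos hint hlog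
  set l := (growthExponent ζ μ).toReal with hl
  have hP := integrable_log_pathWeight hζ hpos hint hlog
  have hκm : Measurable fun z : ℕ → ℝ × ℝ => Real.log (1 + (z 0).2⁻¹) := by fun_prop
  have hκI : Integrable (fun ω => Real.log (1 + (ζ ω 0).2⁻¹)) μ := by
    refine integrable_of_le_of_le (hκm.comp hζ.measurable).aestronglyMeasurable
      (g₁ := fun _ => 0) (g₂ := fun ω => Real.log 2 + |Real.log (ζ ω 0).2|) ?_ ?_
      (integrable_const _) ((integrable_const _).add hlog.abs)
    · filter_upwards [hpos] with ω hω
      exact log_one_add_inv_nonneg (hω 0).2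
    · filter_upwards [hpos] with ω hω
      exact log_one_add_inv_le (hω 0).2
  set κ := ∫ ω, Real.log (1 + (ζ ω 0).2⁻¹) ∂μ with hκ
  have hmean : ∀ n : ℕ, (n + 1) * l - 2 * κ ≤ ∫ ω, Real.log (pathWeight (ζ ω) (n + 2)) ∂μ := by
    intro n
    have h1 := growthExponent_mul_le_integral hζ hpos hint hbot (n + 1)
    have hκI' := hζ.integrable_shift hκm hκI (1 + n)
    have hκ' := (hζ.identDistrib_comp_shift hκm (1 + n)).integral_eq
    have hg := hζ.integrable_shift (measurable_log_growth (n + 1))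
      (integrable_log_growth hζ hpos hint hbot (n + 1)) 1
    have hg' := (hζ.identDistrib_comp_shift (measurable_log_growth (n + 1)) 1).integral_eq
    rw [← hg'] at h1
    have h2 : ∫ ω, Real.log (growth (shift 1 (ζ ω)) (n + 1)) ∂μ ≤
        ∫ ω, (Real.log (1 + (shift (1 + n) (ζ ω) 0).2⁻¹) + (Real.log (1 + (ζ ω 0).2⁻¹)
          + Real.log (pathWeight (ζ ω) (n + 2)))) ∂μ := by
      refine integral_mono_ae hg (hκI'.add (hκI.add (hP _))) ?_
      filter_upwards [hpos] with ω hω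
      have h3 := growth_shift_le_pathWeight hω n
      have hq : ∀ i, 0 < 1 + (ζ ω i).2⁻¹ := fun i => by
        have := inv_pos.2 (hω i).2; linarith
      have hp := pathWeight_pos hω (n + 2)
      have h4 := Real.log_le_log (growth_pos (hω.shift 1) _) h3
      rw [Real.log_mul (hq _).ne' (mul_pos (hq 0) hp).ne', Real.log_mul (hq 0).ne' hp.ne'] at h4
      exact h4
    rw [integral_add hκI' (by exact hκI.add (hP _)), integral_add hκI (hP _), hκ', ← hκ] at h2
    push_cast at h1
    linarith
  have hkey : ∀ j : ℕ, ∀ᵐ ω ∂μ, ∀ ε > 0, ∀ᶠ n : ℕ in atTop, ∀ k ≤ n,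
      -Real.log (pathWeight (shift k (ζ ω)) (n - k))
        ≤ -(l - 1 / ((j : ℝ) + 1)) * ((n : ℝ) - k) + ε * n := by
    intro j
    have hj : (0 : ℝ) < 1 / ((j : ℝ) + 1) := by positivity
    -- blocks so long that the bounded loss `l + 2 * κ` of `hmean` is negligible
    obtain ⟨n, hn⟩ := ((tendsto_natCast_atTop_atTop.const_mul_atTop hj).eventually_gt_atTop
      (l + 2 * κ - 2 * (1 / ((j : ℝ) + 1)))).exists
    have hlt : extExpectation μ (fun ω => -Real.log (pathWeight (ζ ω) (n + 2)))
        < ((((n + 2 : ℕ) : ℝ) * -(l - 1 / ((j : ℝ) + 1)) : ℝ) : EReal) := by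
      rw [extExpectation_eq_integral (by exact (hP (n + 2)).neg), EReal.coe_lt_coe_iff,
        integral_neg]
      have := hmean n
      push_cast
      linarith
    have hm' := (measurable_log_pathWeight (n + 2)).neg
    obtain ⟨C, hC, hCL⟩ := exists_integral_max_lt (hm'.comp hζ.measurable)
      (hP (n + 2)).neg.lintegral_lt_top.ne hlt
    refine hζ.ae_eventually_le (Ψ := fun n z => -Real.log (pathWeight z n))
      (fun n => (measurable_log_pathWeight n).neg)
      (fun n z z' h => by simp only [pathWeight_congr h]) ?_ (fun z => by simp [pathWeight_zero]) ?_
      (Nat.succ_pos (n + 1)) hC hCL.le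
    · filter_upwards [hpos] with ω hω k a b
      have := log_pathWeight_add_ge (hω.shift k) a b
      rw [shift_shift] at this
      linarith
    · exact (hP 1).neg.sup (integrable_const 0)
  filter_upwards [hpos, ae_all_iff.2 hkey] with ω hω hkey ε hε
  obtain ⟨j, hj⟩ := exists_nat_one_div_lt (by positivity : (0 : ℝ) < ε / 3)
  rw [← eventually_map (m := fun n : ℕ => n)
    (P := fun n : ℕ => Real.exp (n * (l - ε)) ≤ linRec (ζ ω) 1 1 n), Filter.map_id',
    ← map_add_atTop_eq_nat 1, eventually_map]
  have h3 : ∀ᶠ n : ℕ in atTop, l ≤ ε / 3 * n :=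
    (tendsto_natCast_atTop_atTop.const_mul_atTop (by positivity)).eventually_ge_atTop _
  filter_upwards [hkey j (ε / 3) (by positivity), h3] with n hn hn3
  have h4 := hn 0 (Nat.zero_le n)
  simp only [shift_zero, Nat.sub_zero, Nat.cast_zero, sub_zero] at h4
  refine le_trans ?_ (pathWeight_le_linRec hω n)
  rw [← Real.le_log_iff_exp_le (pathWeight_pos hω n)]
  push_cast
  have h5 : 1 / ((j : ℝ) + 1) * n ≤ ε / 3 * n := by gcongr
  linarith

end integrableLog

end

/-! ### Independence of the incoming gains, and convergence in probability -/

section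

variable {Ω : Type*} [MeasurableSpace Ω] {μ : Measure Ω}

/-- The rows of an independent family indexed by a product are independent. -/
theorem iIndepFun_curry {ι κ : Type*} {ξ : ι × κ → Ω → ℝ} (hm : ∀ p, Measurable (ξ p))
    (h : iIndepFun ξ μ) : iIndepFun (fun i ω j => ξ (i, j) ω) μ := by
  have hprob : IsProbabilityMeasure μ := h.isProbabilityMeasure
  have hp : ∀ i j, IsProbabilityMeasure (μ.map (ξ (i, j))) := fun i j =>
    Measure.isProbabilityMeasure_map (hm _).aemeasurable
  have hrow : ∀ i, μ.map (fun ω j => ξ (i, j) ω)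
      = Measure.infinitePi fun j => μ.map (ξ (i, j)) := fun i =>
    (iIndepFun_iff_map_fun_eq_infinitePi_map fun j => hm (i, j)).1
      (h.precomp (Prod.mk_right_injective i))
  rw [iIndepFun_iff_map_fun_eq_infinitePi_map
    fun i => measurable_pi_lambda _ fun j => hm (i, j)]
  simp only [hrow]
  rw [← Measure.infinitePi_map_curry fun i j => μ.map (ξ (i, j))]
  have hjoint := (iIndepFun_iff_map_fun_eq_infinitePi_map hm).1 h
  have hjoint : Measure.map (fun ω p => ξ p ω) μ
    = Measure.infinitePi fun p : ι × κ => μ.map (ξ (p.1, p.2)) := hjoint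
  rw [← hjoint, Measure.map_map (MeasurableEquiv.measurable _) (measurable_pi_lambda _ hm)]
  rfl

/-- The two links entering node `i + 2`, indexed by a Boolean. -/
def inLink (p : ℕ × Bool) : Link :=
  if p.2 then ⟨(p.1 + 1, p.1 + 2), Or.inl rfl⟩ else ⟨(p.1, p.1 + 2), Or.inr rfl⟩

theorem inLink_injective : Function.Injective inLink := by
  rintro ⟨i, _ | _⟩ ⟨j, _ | _⟩ h <;> simp [inLink] at h ⊢ <;> omega

theorem isIID_inLinks {η : ℕ → ℕ → Ω → ℝ} (hmeas : ∀ p : Link, Measurable (η p.1.1 p.1.2))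
    (hindep : iIndepFun (fun p : Link => η p.1.1 p.1.2) μ)
    (hident : ∀ p q : Link, IdentDistrib (η p.1.1 p.1.2) (η q.1.1 q.1.2) μ μ) :
    IsIID (fun ω => inLinks fun i j => η i j ω) μ := by
  have hcurry := iIndepFun_curry (ξ := fun p : ℕ × Bool => η (inLink p).1.1 (inLink p).1.2)
    (fun p => hmeas _) (hindep.precomp inLink_injective)
  have hpair : Measurable fun y : Bool → ℝ => (y false, y true) := by fun_prop
  refine ⟨measurable_pi_lambda _ fun i => ?_, hcurry.comp (fun _ y => (y false, y true))
    fun _ => hpair, fun i => ?_⟩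
  · exact (hmeas ⟨(i, i + 2), Or.inr rfl⟩).prodMk (hmeas ⟨(i + 1, i + 2), Or.inl rfl⟩)
  · have hrow : ∀ i, iIndepFun (fun j ω => η (inLink (i, j)).1.1 (inLink (i, j)).1.2 ω) μ :=
      fun i => hindep.precomp (inLink_injective.comp (Prod.mk_right_injective i))
    exact (IdentDistrib.pi (fun j => hident (inLink (i, j)) (inLink (0, j))) (hrow i)
      (hrow 0)).comp hpair

theorem integrable_log_growth_one {η : ℕ → ℕ → Ω → ℝ} [IsFiniteMeasure μ]
    (hmeas : ∀ p : Link, Measurable (η p.1.1 p.1.2))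
    (hpos : ∀ᵐ ω ∂μ, PosSeq (inLinks fun i j => η i j ω))
    (hlog : ∀ p : Link, ∫⁻ ω, ENNReal.ofReal (Real.log (η p.1.1 p.1.2 ω)) ∂μ < ⊤) :
    Integrable (fun ω => Real.log (growth (inLinks fun i j => η i j ω) 1)) μ := by
  have hI : ∀ p : Link, Integrable (fun ω => max (Real.log (η p.1.1 p.1.2 ω)) 0) μ := fun p => by
    have hm := ((hmeas p).log.max measurable_const (f := fun ω => Real.log (η p.1.1 p.1.2 ω))
      (g := fun _ => (0 : ℝ)))
    refine (integrable_iff_lintegral_ofReal hm.aestronglyMeasurable).2 ⟨?_, ?_⟩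
    · simpa [ENNReal.ofReal_max] using (hlog p).ne
    · have : ∀ ω, ENNReal.ofReal (-max (Real.log (η p.1.1 p.1.2 ω)) 0) = 0 := fun ω =>
        ENNReal.ofReal_of_nonpos (by simp)
      simp [this]
  let p : Link := ⟨(0, 2), Or.inr rfl⟩
  let q : Link := ⟨(1, 2), Or.inl rfl⟩
  have hm : Measurable fun ω => Real.log (growth (inLinks fun i j => η i j ω) 1) := by
    simp only [growth_one]
    exact (measurable_const.max ((hmeas q).add (hmeas p))).log
  refine integrable_of_le_of_le hm.aestronglyMeasurable (g₁ := fun _ => 0)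
    (g₂ := fun ω => Real.log 2 + max (Real.log (η 0 2 ω)) 0 + max (Real.log (η 1 2 ω)) 0)
    (ae_of_all _ fun ω => log_growth_one_nonneg _) ?_ (integrable_const _)
    (((integrable_const _).add (hI p)).add (hI q))
  filter_upwards [hpos] with ω hω
  rw [growth_one]
  have hp : 0 < η 0 2 ω := (hω 0).1
  have hq : 0 < η 1 2 ω := (hω 0).2
  have hlogmax : ∀ x : ℝ, 0 < x → Real.log (max 1 x) = max (Real.log x) 0 := fun x hx => by
    rcases le_total x 1 with h | h
    · rw [max_eq_left h, Real.log_one, max_eq_right (Real.log_nonpos hx.le h)]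
    · rw [max_eq_right h, max_eq_left (Real.log_nonneg h)]
  have h1 : (0 : ℝ) < max 1 (η 0 2 ω) := lt_max_of_lt_left one_pos
  have h2 : (0 : ℝ) < max 1 (η 1 2 ω) := lt_max_of_lt_left one_pos
  rw [← hlogmax _ hp, ← hlogmax _ hq, ← Real.log_mul two_ne_zero h1.ne',
    ← Real.log_mul (by positivity) h2.ne']
  refine Real.log_le_log (lt_max_of_lt_left one_pos) ?_
  have h3 := le_max_left 1 (η 0 2 ω)
  have h4 := le_max_right 1 (η 0 2 ω)
  have h5 := le_max_left 1 (η 1 2 ω)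
  have h6 := le_max_right 1 (η 1 2 ω)
  refine max_le ?_ ?_
  · nlinarith
  · change η 1 2 ω + η 0 2 ω ≤ _
    nlinarith

/-- The events `S n` hold with high probability: outside of sets `B n` of vanishing measure, and
almost surely for all large `n`. The sets need not be measurable, and in this form the notion is
stable under intersections without measurability; it implies `μ (S n) → 1`. -/
def HoldsWHP (μ : Measure Ω) (S : ℕ → Set Ω) : Prop :=
  ∃ B : ℕ → Set Ω, Tendsto (fun n => μ (B n)) atTop (𝓝 0) ∧
    ∀ᵐ ω ∂μ, ∀ᶠ n in atTop, ω ∉ B n → ω ∈ S n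

theorem HoldsWHP.of_ae {S : ℕ → Set Ω} (h : ∀ᵐ ω ∂μ, ∀ᶠ n in atTop, ω ∈ S n) : HoldsWHP μ S :=
  ⟨fun _ => ∅, by simp, h.mono fun _ hω => hω.mono fun _ hn _ => hn⟩

theorem HoldsWHP.of_compl {S : ℕ → Set Ω} (h : Tendsto (fun n => μ (S n)ᶜ) atTop (𝓝 0)) :
    HoldsWHP μ S :=
  ⟨fun n => (S n)ᶜ, h, ae_of_all _ fun _ => Eventually.of_forall fun _ hn => not_not.1 hn⟩

theorem HoldsWHP.mp₂ {S T R : ℕ → Set Ω} (hS : HoldsWHP μ S) (hT : HoldsWHP μ T)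
    (h : ∀ᵐ ω ∂μ, ∀ᶠ n in atTop, ω ∈ S n → ω ∈ T n → ω ∈ R n) : HoldsWHP μ R := by
  obtain ⟨B, hB, hBS⟩ := hS
  obtain ⟨B', hB', hBT⟩ := hT
  refine ⟨fun n => B n ∪ B' n, ?_, ?_⟩
  · have := hB.add hB'
    rw [add_zero] at this
    exact tendsto_of_tendsto_of_tendsto_of_le_of_le tendsto_const_nhds this (fun _ => zero_le)
      fun n => measure_union_le _ _
  · filter_upwards [hBS, hBT, h] with ω h1 h2 h3
    filter_upwards [h1, h2, h3] with n h1 h2 h3 hn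
    rw [Set.mem_union, not_or] at hn
    exact h3 (h1 hn.1) (h2 hn.2)

theorem HoldsWHP.tendsto_measure [IsProbabilityMeasure μ] {S : ℕ → Set Ω} (h : HoldsWHP μ S) :
    Tendsto (fun n => μ (S n)) atTop (𝓝 1) := by
  obtain ⟨B, hB, hBS⟩ := h
  set A : ℕ → Set Ω := fun N => {ω | ∀ n ≥ N, ω ∉ B n → ω ∈ S n} with hA
  have hmono : Monotone A := fun N M hNM ω hω n hn => hω n (hNM.trans hn)
  have hunion : μ (⋃ N, A N) = 1 := by
    rw [← measure_univ (μ := μ)]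
    refine measure_congr (eventuallyEq_univ.2 ?_)
    filter_upwards [hBS] with ω hω
    obtain ⟨N, hN⟩ := eventually_atTop.1 hω
    exact Set.mem_iUnion.2 ⟨N, hN⟩
  have hlim : Tendsto (fun n => μ (A n) - μ (B n)) atTop (𝓝 (1 - 0)) := by
    rw [← hunion]
    exact ENNReal.Tendsto.sub (tendsto_measure_iUnion_atTop hmono) hB (Or.inr ENNReal.zero_ne_top)
  rw [tsub_zero] at hlim
  refine tendsto_of_tendsto_of_tendsto_of_le_of_le hlim tendsto_const_nhds (fun n => ?_)
    fun n => prob_le_one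
  refine tsub_le_iff_right.2 ((measure_mono fun ω hω => ?_).trans (measure_union_le _ _))
  by_cases hb : ω ∈ B n
  · exact Or.inr hb
  · exact Or.inl (hω n le_rfl hb)

/-- Diagonal extraction. -/
theorem exists_tendsto_atTop_of_forall_eventually {P : ℕ → ℕ → Prop}
    (h : ∀ k, ∀ᶠ n in atTop, P k n) :
    ∃ φ : ℕ → ℕ, Tendsto φ atTop atTop ∧ ∀ᶠ n in atTop, P (φ n) n := by
  choose N hN using fun k => eventually_atTop.1 (h k)
  refine ⟨fun n => Nat.findGreatest (fun k => N k ≤ n) n, tendsto_atTop.2 fun K => ?_, ?_⟩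
  · filter_upwards [eventually_ge_atTop (max K (N K))] with n hn
    exact Nat.le_findGreatest ((le_max_left _ _).trans hn) ((le_max_right _ _).trans hn)
  · filter_upwards [eventually_ge_atTop (N 0)] with n hn
    exact hN _ n (Nat.findGreatest_spec (P := fun k => N k ≤ n) (Nat.zero_le n) hn)

theorem exists_isLittleO_tendsto_one {a : ℝ → ℕ → ENNReal} (ha : ∀ ε n, a ε n ≤ 1)
    (h : ∀ ε > 0, Tendsto (a ε) atTop (𝓝 1)) :
    ∃ ε : ℕ → ℝ, (∀ n, 0 ≤ ε n) ∧ ((fun n : ℕ => (n : ℝ) * ε n) =o[atTop] fun n : ℕ => (n : ℝ)) ∧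
      Tendsto (fun n => a (ε n) n) atTop (𝓝 1) := by
  have hk : ∀ k : ℕ, ∀ᶠ n in atTop, 1 - ((k : ENNReal) + 1)⁻¹ ≤ a (1 / ((k : ℝ) + 1)) n :=
    fun k => by
      refine ((h _ (by positivity)).eventually (lt_mem_nhds ?_)).mono fun n hn => hn.le
      exact ENNReal.sub_lt_self ENNReal.one_ne_top one_ne_zero
        (ENNReal.inv_ne_zero.2 (by finiteness))
  obtain ⟨φ, hφ, hP⟩ := exists_tendsto_atTop_of_forall_eventually hk
  refine ⟨fun n => 1 / ((φ n : ℝ) + 1), fun n => by positivity, ?_, ?_⟩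
  · refine Asymptotics.isLittleO_of_tendsto (fun n hn => by rw [hn, zero_mul]) ?_
    refine (tendsto_one_div_add_atTop_nhds_zero_nat.comp hφ).congr' ?_
    filter_upwards [eventually_gt_atTop 0] with n hn
    have hn : (n : ℝ) ≠ 0 := by positivity
    simp only [Function.comp]
    field_simp
  · have hlim : Tendsto (fun n => 1 - ((φ n : ENNReal) + 1)⁻¹) atTop (𝓝 1) := by
      have h1 : Tendsto (fun k : ℕ => ((k : ENNReal) + 1)⁻¹) atTop (𝓝 0) := by
        have := (tendsto_add_atTop_iff_nat 1).2 ENNReal.tendsto_inv_nat_nhds_zero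
        simpa using this
      have h2 := ENNReal.Tendsto.sub (tendsto_const_nhds (x := (1 : ENNReal))) (h1.comp hφ)
        (Or.inl ENNReal.one_ne_top)
      simpa using h2
    exact tendsto_of_tendsto_of_tendsto_of_le_of_le' hlim tendsto_const_nhds hP
      (Eventually.of_forall fun n => ha _ n)

end

/-! ### Bounds for the capacity -/

section

variable {Ω : Type*} [MeasurableSpace Ω] {μ : Measure Ω}

section relay

variable {e : Ω → ℕ → ℕ → ℝ} {I₀ : Ω → ℝ} {n₀ δ : ℝ}
  (hζ : IsIID (fun ω => inLinks (e ω)) μ) (hpos : ∀ᵐ ω ∂μ, PosSeq (inLinks (e ω)))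
  (hint : Integrable (fun ω => Real.log (growth (inLinks (e ω)) 1)) μ)
include hζ hpos hint

/-- Almost surely for all large `n`, a signal of the expected size has a capacity of the expected
size. -/
theorem ae_eventually_le_capacity_of_signal
    (hn₀ : 0 < n₀) (hδ0 : 0 ≤ δ) (hδ : δ ≤ n₀)
    (hbot : growthExponent (fun ω => inLinks (e ω)) μ ≠ ⊥) {ε : ℝ} (hε : 0 < ε) :
    ∀ᵐ ω ∂μ, ∀ᶠ n : ℕ in atTop,
      Real.exp (n * ((growthExponent (fun ω => inLinks (e ω)) μ).toReal - ε))
        ≤ signal (e ω) (I₀ ω) n →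
      Real.exp (n * (min 0 (2 * (growthExponent (fun ω => inLinks (e ω)) μ).toReal) - 7 * ε))
        ≤ capacity (e ω) (I₀ ω) n₀ δ n := by
  set l := (growthExponent (fun ω => inLinks (e ω)) μ).toReal with hl
  have hL : growthExponent (fun ω => inLinks (e ω)) μ < ((l + ε : ℝ) : EReal) := by
    rw [← EReal.coe_toReal (growthExponent_lt_top hζ hpos hint).ne hbot, EReal.coe_lt_coe_iff]
    linarith
  filter_upwards [hpos, ae_eventually_log_growth_le hζ hpos hint hL] with ω hω h
  filter_upwards [h ε hε, eventually_ge_atTop 2, eventually_add_mul_le_exp 2 0 hε,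
    eventually_add_mul_le_exp 0 (2 * n₀) hε] with n h1 h2 h3 h4 hsig
  refine le_trans ?_ (le_capacity hω hn₀ hδ0 hδ hε h2 hsig h1 (by simpa using h3)
    (by simpa using h4))
  refine Real.exp_le_exp.2 (mul_le_mul_of_nonneg_left ?_ n.cast_nonneg)
  have : min 0 (2 * l) - 2 * ε ≤ min 0 (2 * l - 2 * max 0 (l + ε)) := by
    rcases le_total (l + ε) 0 with h | h
    · rw [max_eq_left h, mul_zero, sub_zero]; linarith
    · rw [max_eq_right h]
      exact le_min (by linarith [min_le_left 0 (2 * l)]) (by linarith [min_le_left 0 (2 * l)])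
  linarith

variable (h01 : ∀ᵐ ω ∂μ, 0 < e ω 0 1) (hI₀ : ∀ ω, 0 < I₀ ω)
include h01 hI₀

theorem holdsWHP_exp_le_signal (h01m : Measurable fun ω => e ω 0 1) (hI₀m : Measurable I₀)
    (hbot : growthExponent (fun ω => inLinks (e ω)) μ ≠ ⊥) {ε : ℝ} (hε : 0 < ε) :
    HoldsWHP μ fun n => {ω | Real.exp (n *
      ((growthExponent (fun ω => inLinks (e ω)) μ).toReal - ε)) ≤ signal (e ω) (I₀ ω) n} := by
  have hprob : IsProbabilityMeasure μ := hζ.indep.isProbabilityMeasure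
  set l := (growthExponent (fun ω => inLinks (e ω)) μ).toReal with hl
  have hV : Measurable fun ω => Real.log (min (I₀ ω) (e ω 0 1 * I₀ ω)) :=
    (hI₀m.min (h01m.mul hI₀m)).log
  have h1 : HoldsWHP μ fun n => {ω | Real.log (min (I₀ ω) (e ω 0 1 * I₀ ω)) < -(n * (ε / 2))}ᶜ :=
    .of_compl (by simpa using tendsto_measure_lt_neg_mul hV (half_pos hε))
  have h2 : HoldsWHP μ fun n => {ω | Real.log (linRec (inLinks (e ω)) 1 1 n)
      < n * (l - ε / 2)}ᶜ :=
    .of_compl (by simpa using tendsto_measure_log_linRec_lt hζ hpos hint hbot (half_pos hε))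
  refine h1.mp₂ h2 ?_
  filter_upwards [hpos, h01] with ω hω hω1
  refine Eventually.of_forall fun n ha hb => ?_
  simp only [Set.mem_compl_iff, Set.mem_ofPred_eq, not_lt] at ha hb ⊢
  have hm : 0 < min (I₀ ω) (e ω 0 1 * I₀ ω) := lt_min (hI₀ ω) (mul_pos hω1 (hI₀ ω))
  have hr := linRec_pos hω one_pos one_pos n
  rw [signal_eq_linRec]
  refine le_trans ?_ (min_mul_linRec_le hω _ _ n)
  rw [← Real.le_log_iff_exp_le (mul_pos hm hr), Real.log_mul hm.ne' hr.ne']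
  linarith

theorem ae_eventually_exp_le_signal
    (hlog : Integrable (fun ω => Real.log (inLinks (e ω) 0).2) μ) {ε : ℝ} (hε : 0 < ε) :
    ∀ᵐ ω ∂μ, ∀ᶠ n : ℕ in atTop, Real.exp (n *
      ((growthExponent (fun ω => inLinks (e ω)) μ).toReal - ε)) ≤ signal (e ω) (I₀ ω) n := by
  filter_upwards [hpos, h01, ae_eventually_exp_le_linRec hζ hpos hint hlog] with ω hω hω1 h
  have hm : 0 < min (I₀ ω) (e ω 0 1 * I₀ ω) := lt_min (hI₀ ω) (mul_pos hω1 (hI₀ ω))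
  filter_upwards [h (ε / 2) (half_pos hε),
    (tendsto_natCast_atTop_atTop.const_mul_atTop (half_pos hε)).eventually_ge_atTop
      (-Real.log (min (I₀ ω) (e ω 0 1 * I₀ ω)))] with n h1 h2
  have hr := linRec_pos hω one_pos one_pos n
  rw [← Real.le_log_iff_exp_le hr] at h1
  rw [signal_eq_linRec]
  refine le_trans ?_ (min_mul_linRec_le hω _ _ n)
  rw [← Real.le_log_iff_exp_le (mul_pos hm hr), Real.log_mul hm.ne' hr.ne']
  linarith

variable (hn₀ : 0 < n₀) (hδ0 : 0 ≤ δ) (hδ : δ ≤ n₀)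
include hn₀ hδ0 hδ

theorem ae_eventually_capacity_le {L ε : ℝ}
    (hL : growthExponent (fun ω => inLinks (e ω)) μ < L) (hε : 0 < ε) :
    ∀ᵐ ω ∂μ, ∀ᶠ n : ℕ in atTop, 0 < capacity (e ω) (I₀ ω) n₀ δ n ∧
      capacity (e ω) (I₀ ω) n₀ δ n ≤ Real.exp (n * (min 0 (2 * L) + 3 * ε)) := by
  filter_upwards [hpos, h01, ae_eventually_log_growth_le hζ hpos hint hL] with ω hω hω1 h
  refine eventually_capacity_le hω hω1 (hI₀ ω) hn₀ hδ0 hδ hε ?_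
  filter_upwards [h ε hε] with n hn
  simpa using hn 0 (Nat.zero_le n)

/-- The upper bound at any rate above `min 0 (2 λ)`, for a finite exponent `λ`. -/
theorem ae_eventually_capacity_le_of_gt
    (hbot : growthExponent (fun ω => inLinks (e ω)) μ ≠ ⊥) {M : ℝ}
    (hM : min 0 (2 * (growthExponent (fun ω => inLinks (e ω)) μ).toReal) < M) :
    ∀ᵐ ω ∂μ, ∀ᶠ n : ℕ in atTop, 0 < capacity (e ω) (I₀ ω) n₀ δ n ∧
      capacity (e ω) (I₀ ω) n₀ δ n ≤ Real.exp (n * M) := by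
  set l := (growthExponent (fun ω => inLinks (e ω)) μ).toReal with hl
  set t := M - min 0 (2 * l) with ht
  have ht0 : 0 < t := sub_pos.2 hM
  have hL : growthExponent (fun ω => inLinks (e ω)) μ < ((l + t / 4 : ℝ) : EReal) := by
    rw [← EReal.coe_toReal (growthExponent_lt_top hζ hpos hint).ne hbot, EReal.coe_lt_coe_iff]
    linarith
  filter_upwards [ae_eventually_capacity_le hζ hpos hint h01 hI₀ hn₀ hδ0 hδ hL
    (by positivity : 0 < t / 6)] with ω hω
  filter_upwards [hω] with n hn
  refine ⟨hn.1, hn.2.trans (Real.exp_le_exp.2 (mul_le_mul_of_nonneg_left ?_ n.cast_nonneg))⟩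
  have : min 0 (2 * (l + t / 4)) ≤ min 0 (2 * l) + t / 2 := by
    rw [← min_add_add_right]
    exact min_le_min (by linarith) (by linarith)
  linarith

end relay

theorem log_div_mem_Icc {c a b : ℝ} {n : ℕ} (hn : 0 < n) (hc : 0 < c) (ha : Real.exp (n * a) ≤ c)
    (hb : c ≤ Real.exp (n * b)) : a ≤ 1 / (n : ℝ) * Real.log c ∧ 1 / (n : ℝ) * Real.log c ≤ b := by
  have hn : (0 : ℝ) < n := by exact_mod_cast hn
  rw [one_div, le_inv_mul_iff₀ hn, inv_mul_le_iff₀ hn]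
  exact ⟨(Real.le_log_iff_exp_le hc).2 ha, (Real.log_le_iff_le_exp hc).2 hb⟩

theorem isThetaP_of_holdsWHP [IsProbabilityMeasure μ] {c : ℕ → Ω → ℝ} {t : ℝ}
    (hup : ∀ ε > 0, HoldsWHP μ fun n => {ω | c n ω ≤ Real.exp (n * (t + ε))})
    (hlow : ∀ ε > 0, HoldsWHP μ fun n => {ω | Real.exp (n * (t - ε)) ≤ c n ω}) :
    IsThetaP μ c fun n => Real.exp ((n : ℝ) * t) := by
  constructor
  · obtain ⟨ε, h0, ho, h1⟩ := exists_isLittleO_tendsto_one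
      (a := fun ε n => μ {ω | c n ω ≤ Real.exp (n * (t + ε))}) (fun _ _ => prob_le_one)
      fun ε hε => (hup ε hε).tendsto_measure
    refine ⟨fun n => n * ε n, fun n => mul_nonneg n.cast_nonneg (h0 n), ho, ?_⟩
    simpa only [← Real.exp_add, ← mul_add] using h1
  · obtain ⟨ε, h0, ho, h1⟩ := exists_isLittleO_tendsto_one
      (a := fun ε n => μ {ω | Real.exp (n * (t - ε)) ≤ c n ω}) (fun _ _ => prob_le_one)
      fun ε hε => (hlow ε hε).tendsto_measure
    refine ⟨fun n => n * ε n, fun n => mul_nonneg n.cast_nonneg (h0 n), ho, ?_⟩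
    simpa only [← Real.exp_add, ← sub_eq_add_neg, ← mul_sub] using h1

end

end AFRelay

open AFRelay in
theorem theorem1 {Ω : Type*} [MeasurableSpace Ω] (μ : Measure Ω) [IsProbabilityMeasure μ]
    (η : ℕ → ℕ → Ω → ℝ)
    (hmeas : ∀ p : AFRelay.Link, Measurable (η p.1.1 p.1.2))
    (hindep : iIndepFun (fun p : AFRelay.Link => η p.1.1 p.1.2) μ)
    (hident : ∀ p q : AFRelay.Link, IdentDistrib (η p.1.1 p.1.2) (η q.1.1 q.1.2) μ μ)
    (hpos : ∀ p : AFRelay.Link, ∀ᵐ ω ∂μ, 0 < η p.1.1 p.1.2 ω)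
    (hcont : ∀ p : AFRelay.Link, NullSingletonClass (μ.map (η p.1.1 p.1.2)))
    (hlog : ∀ p : AFRelay.Link, ∫⁻ ω, ENNReal.ofReal (Real.log (η p.1.1 p.1.2 ω)) ∂μ < ⊤)
    (D : Set ℝ) (hDpos : D ⊆ Set.Ioi 0) (hDbdd : Bornology.IsBounded D)
    (I₀ : Ω → ℝ) (hI₀meas : Measurable I₀) (hI₀ : ∀ ω, I₀ ω ∈ D)
    (n₀ : ℝ) (hn₀ : 0 < n₀) (δ : ℝ) (hδ : δ = n₀ ∨ δ = 0)
    (c : ℕ → Ω → ℝ)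
    (hc : c = fun n ω => AFRelay.capacity (fun i j => η i j ω) (I₀ ω) n₀ δ n)
    (lam : EReal)
    (hlam : lam = AFRelay.upperLyapunovExponent μ
      (fun ω => AFRelay.infoMatrix (fun i j => η i j ω))) :
    lam < ⊤ ∧
    (lam ≠ ⊥ →
      AFRelay.IsThetaP μ c (fun n => Real.exp ((n : ℝ) * min 0 (2 * lam.toReal)))) ∧
    AFRelay.TendstoInProbability μ (fun n ω => 1 / (n : ℝ) * Real.log (c n ω))
      (min 0 (2 * lam)) ∧
    ((∀ p : AFRelay.Link, Integrable (fun ω => Real.log (η p.1.1 p.1.2 ω)) μ) →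
      lam ≠ ⊥ ∧
      ∀ᵐ ω ∂μ, Tendsto (fun n : ℕ => ((1 / (n : ℝ) * Real.log (c n ω) : ℝ) : EReal)) atTop
        (𝓝 (min 0 (2 * lam)))) := by
  set e : Ω → ℕ → ℕ → ℝ := fun ω i j => η i j ω with he
  have hδ0 : 0 ≤ δ := by rcases hδ with rfl | rfl; exacts [hn₀.le, le_rfl]
  have hδn : δ ≤ n₀ := by rcases hδ with rfl | rfl; exacts [le_rfl, hn₀.le]
  have hIpos : ∀ ω, 0 < I₀ ω := fun ω => hDpos (hI₀ ω)
  have h01 : ∀ᵐ ω ∂μ, 0 < e ω 0 1 := hpos ⟨(0, 1), Or.inl rfl⟩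
  have h01m : Measurable fun ω => e ω 0 1 := hmeas ⟨(0, 1), Or.inl rfl⟩
  have hζ : IsIID (fun ω => inLinks (e ω)) μ := isIID_inLinks hmeas hindep hident
  have hP : ∀ᵐ ω ∂μ, PosSeq (inLinks (e ω)) := by
    filter_upwards [ae_all_iff.2 hpos] with ω hω i
    exact ⟨hω ⟨(i, i + 2), Or.inr rfl⟩, hω ⟨(i + 1, i + 2), Or.inl rfl⟩⟩
  have hint : Integrable (fun ω => Real.log (growth (inLinks (e ω)) 1)) μ :=
    integrable_log_growth_one hmeas hP hlog
  rw [upperLyapunovExponent_infoMatrix hP] at hlam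
  have htop : lam < ⊤ := hlam ▸ growthExponent_lt_top hζ hP hint
  have hup : lam ≠ ⊥ → ∀ ε > 0, ∀ᵐ ω ∂μ, ∀ᶠ n : ℕ in atTop, 0 < c n ω ∧
      c n ω ≤ Real.exp (n * (min 0 (2 * lam.toReal) + ε)) := fun hbot ε hε => by
    rw [hlam] at hbot ⊢
    rw [hc]
    exact ae_eventually_capacity_le_of_gt hζ hP hint h01 hIpos hn₀ hδ0 hδn hbot (by linarith)
  have hlow : lam ≠ ⊥ → ∀ ε > 0, HoldsWHP μ fun n : ℕ =>
      {ω | Real.exp (n * (min 0 (2 * lam.toReal) - ε)) ≤ c n ω} := fun hbot ε hε => by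
    rw [hlam] at hbot ⊢
    rw [hc]
    have h1 := holdsWHP_exp_le_signal hζ hP hint h01 hIpos h01m hI₀meas hbot
      (by positivity : 0 < ε / 7)
    refine h1.mp₂ h1 ?_
    filter_upwards [ae_eventually_le_capacity_of_signal hζ hP hint hn₀ hδ0 hδn hbot
      (by positivity : 0 < ε / 7)] with ω hω
    filter_upwards [hω] with n hn hsig _
    have := hn hsig
    rwa [mul_div_cancel₀ ε (by norm_num : (7 : ℝ) ≠ 0)] at this
  have hcoe : lam ≠ ⊥ → min 0 (2 * lam) = ((min 0 (2 * lam.toReal) : ℝ) : EReal) := fun hbot => by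
    rw [EReal.coe_strictMono.monotone.map_min, EReal.coe_mul, EReal.coe_toReal htop.ne hbot]
    norm_cast
  refine ⟨htop, fun hbot => isThetaP_of_holdsWHP (fun ε hε => .of_ae ?_) (hlow hbot), ?_, ?_⟩
  · filter_upwards [hup hbot ε hε] with ω hω
    exact hω.mono fun n hn => hn.2
  · intro U hU
    by_cases hbot : lam = ⊥
    · rw [hbot, EReal.mul_bot_of_pos two_pos, min_eq_right bot_le] at hU
      obtain ⟨y, hy⟩ := EReal.mem_nhds_bot_iff.1 hU
      refine HoldsWHP.tendsto_measure (.of_ae ?_)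
      have hL : growthExponent (fun ω => inLinks (e ω)) μ < (((y - 2) / 2 : ℝ) : EReal) := by
        rw [← hlam, hbot]; exact EReal.bot_lt_coe _
      filter_upwards [ae_eventually_capacity_le hζ hP hint h01 hIpos hn₀ hδ0 hδn hL
        (by norm_num : (0 : ℝ) < 1 / 3)] with ω hω
      filter_upwards [hω, eventually_gt_atTop 0] with n hn hn0
      refine hy (EReal.coe_lt_coe_iff.2 ?_)
      have h := (log_div_mem_Icc hn0 hn.1
        (a := 1 / (n : ℝ) * Real.log (capacity (e ω) (I₀ ω) n₀ δ n)) ?_ hn.2).2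
      · rw [hc]
        linarith [min_le_right 0 (2 * ((y - 2) / 2))]
      · have hn0 : (n : ℝ) ≠ 0 := by positivity
        rw [← mul_assoc, mul_one_div_cancel hn0, one_mul, Real.exp_log hn.1]
    · rw [hcoe hbot, EReal.nhds_coe] at hU
      obtain ⟨ε, hε, hball⟩ := Metric.mem_nhds_iff.1 (mem_map.1 hU)
      refine HoldsWHP.tendsto_measure ((hlow hbot (ε / 2) (half_pos hε)).mp₂
        (hlow hbot (ε / 2) (half_pos hε)) ?_)
      filter_upwards [hup hbot (ε / 2) (half_pos hε)] with ω hω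
      filter_upwards [hω, eventually_gt_atTop 0] with n hn hn0 h1 _
      have h := log_div_mem_Icc hn0 hn.1 h1 hn.2
      refine hball ?_
      rw [Metric.mem_ball, Real.dist_eq, abs_lt]
      constructor <;> linarith [h.1, h.2]
  · intro hI
    have hlogq : Integrable (fun ω => Real.log (inLinks (e ω) 0).2) μ :=
      hI ⟨(1, 2), Or.inl rfl⟩
    have hbot : lam ≠ ⊥ := hlam ▸ growthExponent_ne_bot hζ hP hint hlogq
    refine ⟨hbot, ?_⟩
    have hboth : ∀ j : ℕ, ∀ᵐ ω ∂μ, ∀ᶠ n : ℕ in atTop,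
        min 0 (2 * lam.toReal) - 1 / ((j : ℝ) + 1) ≤ 1 / (n : ℝ) * Real.log (c n ω) ∧
        1 / (n : ℝ) * Real.log (c n ω) ≤ min 0 (2 * lam.toReal) + 1 / ((j : ℝ) + 1) := fun j => by
      have hj : (0 : ℝ) < 1 / ((j : ℝ) + 1) := by positivity
      have hbot' : growthExponent (fun ω => inLinks (e ω)) μ ≠ ⊥ := hlam ▸ hbot
      filter_upwards [hup hbot _ hj,
        ae_eventually_le_capacity_of_signal hζ hP hint hn₀ hδ0 hδn hbot'
          (by positivity : 0 < 1 / ((j : ℝ) + 1) / 7),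
        ae_eventually_exp_le_signal hζ hP hint h01 hIpos hlogq
          (by positivity : 0 < 1 / ((j : ℝ) + 1) / 7)] with ω h1 h2 h3
      filter_upwards [h1, h2, h3, eventually_gt_atTop 0] with n h1 h2 h3 hn
      refine log_div_mem_Icc hn h1.1 ?_ h1.2
      have := h2 h3
      rw [mul_div_cancel₀ _ (by norm_num : (7 : ℝ) ≠ 0), ← hlam] at this
      rwa [hc]
    filter_upwards [ae_all_iff.2 hboth] with ω hω
    rw [hcoe hbot]
    refine (continuous_coe_real_ereal.tendsto _).comp (Metric.tendsto_nhds.2 fun ε hε => ?_)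
    obtain ⟨j, hj⟩ := exists_nat_one_div_lt hε
    filter_upwards [hω j] with n hn
    rw [Real.dist_eq, abs_lt]
    constructor <;> linarith [hn.1, hn.2]
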